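/- Let $\mathbb{D}=\{z\in\mathbb{C}:|z|<1\}$, $\mathbb{T}=\partial\mathbb{D}$, and let $m$ be normalised Lebesgue measure on $\mathbb{T}$. For $1\le p<\infty$ let $H^p(\mathbb{D})$ be the space of analytic functions $f$ on $\mathbb{D}$ with $\|f\|^p=\sup_{0<r<1}\int_{\mathbb{T}}|f(rt)|^p\,dm(t)<\infty$. An analytic function $\phi$ on $\mathbb{D}$ with $|\phi|\le 1$ is called inner if, for $m$-almost every $t\in\mathbb{T}$, the radial limit $\lim_{r\to1^-}\phi(rt)$ exists and has modulus $1$. A bounded operator $T$ on a normed space is called similar to an isometry if $T=S^{-1}US$ for some boundedly invertible operator $S$ and some linear isometry $U$ (not necessarily surjective) on that space. Proposition. Let $a\in\mathbb{T}$, and let $\phi$ be analytic on some open neighbourhood $\Omega$ of $\overline{\mathbb{D}}\setminus\{a\}$, with $\phi(\mathbb{D})\subseteq\mathbb{D}$. Suppose that for some $p\in[1,\infty)$ and some weight $\psi:\mathbb{D}\to\mathbb{C}$ the weighted composition operator $W_{\phi,\psi}f=\psi\cdot(f\circ\phi)$ is a bounded operator from $H^p(\mathbb{D})$ to itself that is similar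 to an isometry. Then $\phi$ is inner. -/

import Mathlib

open Set Metric Filter Topology MeasureTheory
open scoped Complex.UnitDisc Pointwise

noncomputable section

namespace HardyDisc

/-- Extension by zero to the whole plane of a function on the open unit disc `𝔻`. -/
def discExt (f : 𝔻 → ℂ) (z : ℂ) : ℂ :=
  if h : ‖z‖ < 1 then f (Complex.UnitDisc.mk z h) else 0

/-- Analyticity of a function on the open unit disc. -/
def AnalyticOnDisc (f : 𝔻 → ℂ) : Prop :=
  DifferentiableOn ℂ (discExt f) (ball 0 1)

/-- The integral mean `∫_𝕋 |f(r t)|^p dm(t)`, where `m` is normalised Lebesgue measure on the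
unit circle. -/
def hardyMean (p : ℝ) (f : 𝔻 → ℂ) (r : ℝ) : ℝ :=
  Real.circleAverage (fun z => ‖discExt f z‖ ^ p) 0 r

/-- Membership in `H^p(𝔻)`: `f` is analytic and its integral means over the circles of radius
`0 < r < 1` are bounded. -/
def MemHardy (p : ℝ) (f : 𝔻 → ℂ) : Prop :=
  AnalyticOnDisc f ∧ BddAbove (hardyMean p f '' Ioo 0 1)

/-- The Hardy norm, `‖f‖^p = sup_{0<r<1} ∫_𝕋 |f(r t)|^p dm(t)`. -/
def hardyNorm (p : ℝ) (f : 𝔻 → ℂ) : ℝ :=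
  (sSup (hardyMean p f '' Ioo 0 1)) ^ (1 / p)

theorem discExt_coe (f : 𝔻 → ℂ) (z : 𝔻) : discExt f z = f z := by
  simp [discExt, z.norm_lt_one]

theorem discExt_add (f g : 𝔻 → ℂ) : discExt (f + g) = discExt f + discExt g := by
  funext z
  by_cases h : ‖z‖ < 1 <;> simp [discExt, h]

theorem discExt_smul (c : ℂ) (f : 𝔻 → ℂ) : discExt (c • f) = c • discExt f := by
  funext z
  by_cases h : ‖z‖ < 1 <;> simp [discExt, h]

theorem discExt_zero : discExt 0 = 0 := by
  funext z
  by_cases h : ‖z‖ < 1 <;> simp [discExt]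

theorem continuous_slice {f : 𝔻 → ℂ} (hf : AnalyticOnDisc f) {r : ℝ} (hr : r ∈ Ioo (0 : ℝ) 1) :
    Continuous (fun θ : ℝ => discExt f (circleMap 0 r θ)) := by
  refine hf.continuousOn.comp_continuous (continuous_circleMap 0 r) fun θ => ?_
  simp [abs_of_pos hr.1, hr.2]

theorem hardyMean_nonneg (p : ℝ) (f : 𝔻 → ℂ) (r : ℝ) : 0 ≤ hardyMean p f r :=
  Real.circleAverage_nonneg_of_nonneg fun _ _ => by positivity

theorem hardyMean_eq (p : ℝ) (f : 𝔻 → ℂ) (r : ℝ) :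
    hardyMean p f r = (2 * Real.pi)⁻¹ *
      ∫ θ in Ioc 0 (2 * Real.pi), ‖discExt f (circleMap 0 r θ)‖ ^ p := by
  rw [hardyMean, Real.circleAverage_def, intervalIntegral.integral_of_le Real.two_pi_pos.le,
    smul_eq_mul]

/-- The means to the power `1 / p` are (up to a constant) `L^p` norms. -/
theorem hardyMean_rpow {p : ℝ} (hp : 1 ≤ p) {f : 𝔻 → ℂ} (hf : AnalyticOnDisc f) {r : ℝ}
    (hr : r ∈ Ioo (0 : ℝ) 1) :
    MemLp (fun θ : ℝ => discExt f (circleMap 0 r θ)) (ENNReal.ofReal p)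
        (volume.restrict (Ioc 0 (2 * Real.pi))) ∧
      hardyMean p f r ^ (1 / p) = ((2 * Real.pi)⁻¹) ^ (1 / p) *
        (eLpNorm (fun θ : ℝ => discExt f (circleMap 0 r θ)) (ENNReal.ofReal p)
          (volume.restrict (Ioc 0 (2 * Real.pi)))).toReal := by
  have hp0 : 0 < p := by linarith
  have hc := continuous_slice hf hr
  have hm : MemLp (fun θ : ℝ => discExt f (circleMap 0 r θ)) (ENNReal.ofReal p)
      (volume.restrict (Ioc 0 (2 * Real.pi))) := by
    obtain ⟨C, hC⟩ := (isCompact_Icc (a := (0 : ℝ)) (b := 2 * Real.pi)).exists_bound_of_continuousOn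
      hc.continuousOn
    refine MemLp.of_bound hc.aestronglyMeasurable C ?_
    exact (ae_restrict_iff' measurableSet_Ioc).2
      (Eventually.of_forall fun θ hθ => hC θ (Ioc_subset_Icc_self hθ))
  refine ⟨hm, ?_⟩
  rw [hm.eLpNorm_eq_integral_rpow_norm (by simpa using hp0) ENNReal.ofReal_ne_top,
    ENNReal.toReal_ofReal (by positivity), ENNReal.toReal_ofReal hp0.le, hardyMean_eq,
    Real.mul_rpow (by positivity) (by positivity), one_div]

theorem hardyMean_add_le {p : ℝ} (hp : 1 ≤ p) {f g : 𝔻 → ℂ} (hf : AnalyticOnDisc f)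
    (hg : AnalyticOnDisc g) {r : ℝ} (hr : r ∈ Ioo (0 : ℝ) 1) :
    hardyMean p (f + g) r ^ (1 / p) ≤ hardyMean p f r ^ (1 / p) + hardyMean p g r ^ (1 / p) := by
  have hfg : AnalyticOnDisc (f + g) := by
    rw [AnalyticOnDisc, discExt_add]; exact DifferentiableOn.add hf hg
  obtain ⟨mf, ef⟩ := hardyMean_rpow hp hf hr
  obtain ⟨mg, eg⟩ := hardyMean_rpow hp hg hr
  obtain ⟨-, e⟩ := hardyMean_rpow hp hfg hr
  rw [ef, eg, e, ← mul_add, ← ENNReal.toReal_add mf.2.ne mg.2.ne]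
  refine mul_le_mul_of_nonneg_left ?_ (by positivity)
  refine ENNReal.toReal_mono (ENNReal.add_ne_top.2 ⟨mf.2.ne, mg.2.ne⟩) ?_
  rw [discExt_add]
  exact eLpNorm_add_le mf.1 mg.1 (by simpa using ENNReal.ofReal_le_ofReal hp)

theorem hardyMean_smul (p : ℝ) (c : ℂ) (f : 𝔻 → ℂ) (r : ℝ) :
    hardyMean p (c • f) r = ‖c‖ ^ p * hardyMean p f r := by
  rw [hardyMean_eq, hardyMean_eq, discExt_smul]
  simp only [Pi.smul_apply, norm_smul]
  simp_rw [Real.mul_rpow (norm_nonneg _) (norm_nonneg _)]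
  rw [integral_const_mul]
  ring

theorem hardyMean_rpow_le {p : ℝ} (hp : 1 ≤ p) {f : 𝔻 → ℂ} (hf : MemHardy p f) {r : ℝ}
    (hr : r ∈ Ioo (0 : ℝ) 1) : hardyMean p f r ^ (1 / p) ≤ hardyNorm p f :=
  Real.rpow_le_rpow (hardyMean_nonneg p f r) (le_csSup hf.2 (mem_image_of_mem _ hr))
    (by have : 0 < p := by linarith
        positivity)

theorem hardyNorm_nonneg (p : ℝ) (f : 𝔻 → ℂ) : 0 ≤ hardyNorm p f :=
  Real.rpow_nonneg (Real.sSup_nonneg (by rintro _ ⟨r, -, rfl⟩; exact hardyMean_nonneg p f r)) _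

theorem hardyMean_le_of_rpow_le {p : ℝ} (hp : 1 ≤ p) {f : 𝔻 → ℂ} {r C : ℝ}
    (h : hardyMean p f r ^ (1 / p) ≤ C) : hardyMean p f r ≤ C ^ p := by
  have hp0 : 0 < p := by linarith
  have h2 := Real.rpow_le_rpow (Real.rpow_nonneg (hardyMean_nonneg p f r) _) h hp0.le
  rwa [← Real.rpow_mul (hardyMean_nonneg p f r), one_div_mul_cancel hp0.ne', Real.rpow_one] at h2

theorem hardyNorm_le {p : ℝ} (hp : 1 ≤ p) {f : 𝔻 → ℂ} {C : ℝ} (hC : 0 ≤ C)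
    (h : ∀ r ∈ Ioo (0 : ℝ) 1, hardyMean p f r ^ (1 / p) ≤ C) : hardyNorm p f ≤ C := by
  have hp0 : 0 < p := by linarith
  have h1 : sSup (hardyMean p f '' Ioo 0 1) ≤ C ^ p := by
    refine csSup_le (Set.Nonempty.image _ ⟨1 / 2, by norm_num, by norm_num⟩) ?_
    rintro _ ⟨r, hr, rfl⟩
    exact hardyMean_le_of_rpow_le hp (h r hr)
  have h2 := Real.rpow_le_rpow
    (Real.sSup_nonneg (by rintro _ ⟨r, -, rfl⟩; exact hardyMean_nonneg p f r)) h1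
    (by positivity : 0 ≤ 1 / p)
  rwa [← Real.rpow_mul hC, mul_one_div_cancel hp0.ne', Real.rpow_one] at h2

theorem MemHardy.add {p : ℝ} (hp : 1 ≤ p) {f g : 𝔻 → ℂ} (hf : MemHardy p f)
    (hg : MemHardy p g) : MemHardy p (f + g) := by
  refine ⟨?_, (hardyNorm p f + hardyNorm p g) ^ p, ?_⟩
  · rw [AnalyticOnDisc, discExt_add]; exact DifferentiableOn.add hf.1 hg.1
  · rintro _ ⟨r, hr, rfl⟩
    exact hardyMean_le_of_rpow_le hp ((hardyMean_add_le hp hf.1 hg.1 hr).trans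
      (add_le_add (hardyMean_rpow_le hp hf hr) (hardyMean_rpow_le hp hg hr)))

theorem MemHardy.smul {p : ℝ} (c : ℂ) {f : 𝔻 → ℂ} (hf : MemHardy p f) :
    MemHardy p (c • f) := by
  obtain ⟨C, hC⟩ := hf.2
  refine ⟨?_, ‖c‖ ^ p * C, ?_⟩
  · rw [AnalyticOnDisc, discExt_smul]; exact DifferentiableOn.const_smul hf.1 c
  · rintro _ ⟨r, hr, rfl⟩
    rw [hardyMean_smul]
    exact mul_le_mul_of_nonneg_left (hC (mem_image_of_mem _ hr)) (by positivity)

theorem hardyMean_zero {p : ℝ} (hp : 1 ≤ p) (r : ℝ) : hardyMean p 0 r = 0 := by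
  rw [hardyMean_eq, discExt_zero]
  simp [Real.zero_rpow (by linarith : p ≠ 0)]

theorem MemHardy.zero {p : ℝ} (hp : 1 ≤ p) : MemHardy p 0 := by
  refine ⟨?_, 0, ?_⟩
  · rw [AnalyticOnDisc, discExt_zero]; exact differentiableOn_const 0
  · rintro _ ⟨r, -, rfl⟩
    exact (hardyMean_zero hp r).le

theorem hardyNorm_add_le {p : ℝ} (hp : 1 ≤ p) {f g : 𝔻 → ℂ} (hf : MemHardy p f)
    (hg : MemHardy p g) : hardyNorm p (f + g) ≤ hardyNorm p f + hardyNorm p g :=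
  hardyNorm_le hp (add_nonneg (hardyNorm_nonneg p f) (hardyNorm_nonneg p g)) fun _ hr =>
    (hardyMean_add_le hp hf.1 hg.1 hr).trans
      (add_le_add (hardyMean_rpow_le hp hf hr) (hardyMean_rpow_le hp hg hr))

theorem hardyNorm_smul {p : ℝ} (hp : 1 ≤ p) (c : ℂ) (f : 𝔻 → ℂ) :
    hardyNorm p (c • f) = ‖c‖ * hardyNorm p f := by
  have hp0 : 0 < p := by linarith
  have h : hardyMean p (c • f) '' Ioo 0 1 = (‖c‖ ^ p) • (hardyMean p f '' Ioo 0 1) := by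
    rw [← Set.image_smul, Set.image_image]
    exact Set.image_congr fun r _ => by rw [hardyMean_smul, smul_eq_mul]
  rw [hardyNorm, h, Real.sSup_smul_of_nonneg (by positivity), smul_eq_mul,
    Real.mul_rpow (by positivity)
      (Real.sSup_nonneg (by rintro _ ⟨r, -, rfl⟩; exact hardyMean_nonneg p f r)),
    ← Real.rpow_mul (norm_nonneg c), mul_one_div_cancel hp0.ne', Real.rpow_one, hardyNorm]

theorem eq_zero_of_hardyNorm_eq_zero {p : ℝ} (hp : 1 ≤ p) {f : 𝔻 → ℂ} (hf : MemHardy p f)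
    (h : hardyNorm p f = 0) : f = 0 := by
  have hp0 : 0 < p := by linarith
  have key : ∀ r ∈ Ioo (0 : ℝ) 1, ∀ θ ∈ Ioo (0 : ℝ) (2 * Real.pi),
      discExt f (circleMap 0 r θ) = 0 := by
    intro r hr
    obtain ⟨hm, e⟩ := hardyMean_rpow hp hf.1 hr
    have h1 : hardyMean p f r ^ (1 / p) = 0 :=
      le_antisymm ((hardyMean_rpow_le hp hf hr).trans h.le)
        (Real.rpow_nonneg (hardyMean_nonneg p f r) _)
    rw [h1] at e
    have h2 := (mul_eq_zero.1 e.symm).resolve_left (by positivity)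
    have h3 := ((ENNReal.toReal_eq_zero_iff _).1 h2).resolve_right hm.2.ne
    rw [eLpNorm_eq_zero_iff hm.1 (by simpa using hp0)] at h3
    have h4 := ae_restrict_of_ae_restrict_of_subset Ioo_subset_Ioc_self h3
    exact Measure.eqOn_open_of_ae_eq h4 isOpen_Ioo (continuous_slice hf.1 hr).continuousOn
      continuousOn_const
  have hcirc : ∀ r ∈ Ioo (0 : ℝ) 1, ∀ θ : ℝ, discExt f (circleMap 0 r θ) = 0 := by
    intro r hr
    have hcl : ∀ θ ∈ Icc (0 : ℝ) (2 * Real.pi), discExt f (circleMap 0 r θ) = 0 := by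
      have hs : IsClosed {θ : ℝ | discExt f (circleMap 0 r θ) = 0} :=
        isClosed_eq (continuous_slice hf.1 hr) continuous_const
      have := closure_minimal (s := Ioo (0 : ℝ) (2 * Real.pi)) (key r hr) hs
      rw [closure_Ioo Real.two_pi_pos.ne] at this
      exact this
    intro θ
    obtain ⟨y, hy, hy'⟩ := (periodic_circleMap 0 r).exists_mem_Ico₀ Real.two_pi_pos θ
    rw [hy']
    exact hcl y (Ico_subset_Icc_self hy)
  have hne : ∀ z : ℂ, z ∈ ball (0 : ℂ) 1 → z ≠ 0 → discExt f z = 0 := by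
    intro z hz hz0
    have := hcirc ‖z‖ ⟨norm_pos_iff.2 hz0, by simpa using hz⟩ z.arg
    simpa [circleMap, Complex.norm_mul_exp_arg_mul_I] using this
  have h0 : discExt f 0 = 0 := by
    have hc : ContinuousAt (discExt f) 0 := hf.1.continuousOn.continuousAt (ball_mem_nhds 0 one_pos)
    have ht : Tendsto (discExt f) (𝓝[≠] 0) (𝓝 (discExt f 0)) := hc.tendsto.mono_left inf_le_left
    have ht0 : Tendsto (discExt f) (𝓝[≠] 0) (𝓝 0) := by
      refine tendsto_const_nhds.congr' ?_
      filter_upwards [self_mem_nhdsWithin, mem_nhdsWithin_of_mem_nhds (ball_mem_nhds 0 one_pos)]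
        with z hz hz1
      exact (hne z hz1 hz).symm
    exact tendsto_nhds_unique ht ht0
  funext z
  rw [← discExt_coe f z]
  by_cases hz : (z : ℂ) = 0
  · rw [hz, h0]; rfl
  · exact hne z (by simpa using z.norm_lt_one) hz

/-- `H^p(𝔻)` as a linear subspace of the functions on the disc. -/
def hardySubmodule (p : ℝ) [Fact (1 ≤ p)] : Submodule ℂ (𝔻 → ℂ) where
  carrier := {f | MemHardy p f}
  add_mem' hf hg := MemHardy.add Fact.out hf hg
  zero_mem' := MemHardy.zero Fact.out
  smul_mem' c _ hf := MemHardy.smul c hf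

/-- The Hardy space `H^p(𝔻)`, `1 ≤ p < ∞`. It is a type of its own, so that it carries the topology
of the Hardy norm and not that of pointwise convergence. -/
def HardySpace (p : ℝ) [Fact (1 ≤ p)] : Type := hardySubmodule p

namespace HardySpace

variable {p : ℝ} [Fact (1 ≤ p)]

instance : AddCommGroup (HardySpace p) := inferInstanceAs (AddCommGroup (hardySubmodule p))

instance : Module ℂ (HardySpace p) := inferInstanceAs (Module ℂ (hardySubmodule p))

/-- The function on the disc underlying an element of `H^p(𝔻)`. -/
def toFun (f : HardySpace p) : 𝔻 → ℂ := Subtype.val f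

instance : CoeFun (HardySpace p) (fun _ => 𝔻 → ℂ) := ⟨toFun⟩

instance : Norm (HardySpace p) := ⟨fun f => hardyNorm p f.toFun⟩

theorem core : NormedSpace.Core ℂ (HardySpace p) where
  norm_nonneg f := hardyNorm_nonneg p f.toFun
  norm_smul c f := hardyNorm_smul Fact.out c f.toFun
  norm_triangle f g := hardyNorm_add_le Fact.out f.2 g.2
  norm_eq_zero_iff f := by
    constructor
    · exact fun h => Subtype.ext (eq_zero_of_hardyNorm_eq_zero Fact.out f.2 h)
    · rintro rfl
      have := hardyNorm_smul (p := p) Fact.out 0 0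
      rwa [zero_smul, norm_zero, zero_mul] at this

instance : NormedAddCommGroup (HardySpace p) := NormedAddCommGroup.ofCore core

instance : NormedSpace ℂ (HardySpace p) := NormedSpace.ofCore core

end HardySpace

/-- The self-map of the disc given by a function on the plane that maps the disc to itself. -/
def discMap (φ : ℂ → ℂ) (hφ : MapsTo φ (ball 0 1) (ball 0 1)) : 𝔻 → 𝔻 :=
  fun z => Complex.UnitDisc.mk (φ z)
    (mem_ball_zero_iff.1 (hφ (mem_ball_zero_iff.2 z.norm_lt_one)))

/-- `T` is the weighted composition operator `W_{φ,ψ} f = ψ · (f ∘ φ)` on `H^p(𝔻)`. -/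
def IsWeightedComposition {p : ℝ} [Fact (1 ≤ p)] (φ : 𝔻 → 𝔻) (ψ : 𝔻 → ℂ)
    (T : HardySpace p →L[ℂ] HardySpace p) : Prop :=
  ∀ (f : HardySpace p) (z : 𝔻), T f z = ψ z * f (φ z)

/-- `T = S⁻¹ U S` for some (boundedly) invertible operator `S` and some linear isometry `U`. -/
def IsSimilarToIsometry {E : Type*} [NormedAddCommGroup E] [NormedSpace ℂ E] (T : E →L[ℂ] E) :
    Prop :=
  ∃ (S : E ≃L[ℂ] E) (U : E →ₗᵢ[ℂ] E), ∀ x, T x = S.symm (U (S x))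

/-- Inner functions: analytic on the disc, bounded by one, with radial limits of modulus one at
almost every point of the circle. -/
structure IsInner (φ : ℂ → ℂ) : Prop where
  analytic : DifferentiableOn ℂ φ (ball 0 1)
  norm_le_one : ∀ z ∈ ball (0 : ℂ) 1, ‖φ z‖ ≤ 1
  radial_limit : ∀ᵐ θ ∂(volume.restrict (Ioc 0 (2 * Real.pi))),
    ∃ w : ℂ, ‖w‖ = 1 ∧ Tendsto (fun r : ℝ => φ (circleMap 0 r θ)) (𝓝[<] 1) (𝓝 w)

end HardyDisc

end

namespace HardyDisc

/-! The function |φ|² - 1 is real-analytic on 𝕋 \ {a}, which is an analytic copy of ℝ. Hence either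
|φ| = 1 on the whole punctured circle, and φ is inner by continuity, or |φ| < 1 almost everywhere on
𝕋 (`forall_norm_eq_one_or_ae_norm_lt_one`). The second case is impossible: an operator similar to an
isometry is bounded below, and the monomials z^k have norm at least 1, yet W z^k = φ^k F with F = W
1 would tend to 0 in H^p.

This decay has to be uniform in the radius (`exists_forall_integral_pow_mul_le`). No boundary values
of F are used; instead |F|^p is dominated by the Poisson integral of an integrable G
(`exists_poisson_majorant`). Fubini and the symmetry of the Poisson kernel move the kernel onto
|φ|^(pk), whose Poisson means converge to its boundary values, and dominated convergence against G
finishes.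

The majorant G is the square of a weak L² limit of |F|^(p/2) on circles r → 1; squaring is what
makes p = 1 accessible. It rests on the Poisson inequality for |f|^q, which follows from harmonicity
of log |f| once the zeros of f are divided out by Blaschke factors. -/

/-! ### The Poisson inequality for powers of zero-free functions -/

theorem poissonKernel_zero_nonneg {w z : ℂ} (hw : w ∈ ball (0 : ℂ) 1)
    (hz : z ∈ sphere (0 : ℂ) 1) : 0 ≤ poissonKernel 0 w z := by
  rw [mem_ball_zero_iff] at hw
  rw [mem_sphere_zero_iff_norm] at hz
  rw [poissonKernel_def, sub_zero, sub_zero, hz]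
  have : ‖w‖ ^ 2 ≤ 1 := by nlinarith [norm_nonneg w]
  exact div_nonneg (by linarith) (by positivity)

theorem sub_ne_zero_of_mem_sphere_of_mem_ball {w z : ℂ} (hw : w ∈ ball (0 : ℂ) 1)
    (hz : z ∈ sphere (0 : ℂ) 1) : z - w ≠ 0 := by
  rw [mem_ball_zero_iff] at hw
  rw [mem_sphere_zero_iff_norm] at hz
  intro h
  rw [sub_eq_zero.1 h] at hz
  exact hw.ne hz

theorem continuousOn_poissonKernel_zero {w : ℂ} (hw : w ∈ ball (0 : ℂ) 1) :
    ContinuousOn (poissonKernel 0 w) (sphere 0 1) := by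
  have : poissonKernel 0 w = fun z => (‖z‖ ^ 2 - ‖w‖ ^ 2) / ‖z - w‖ ^ 2 := by
    funext z; simp [poissonKernel_def]
  rw [this]
  refine ContinuousOn.div (by fun_prop) (by fun_prop) fun z hz => ?_
  exact pow_ne_zero 2 (norm_ne_zero_iff.2 (sub_ne_zero_of_mem_sphere_of_mem_ball hw hz))

theorem circleAverage_poissonKernel_zero {w : ℂ} (hw : w ∈ ball (0 : ℂ) 1) :
    Real.circleAverage (poissonKernel 0 w) 0 1 = 1 := by
  have h := InnerProductSpace.HarmonicOnNhd.circleAverage_poissonKernel_smul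
    (f := fun _ => (1 : ℝ)) (c := 0) (R := 1)
    (fun x _ => InnerProductSpace.harmonicAt_const 1) hw
  rw [← h]
  congr 1
  funext z
  simp

/-- A tangent-line inequality for `x ↦ x ^ q` in the variable `log x`. -/
theorem rpow_mul_one_add_log_le {x c q : ℝ} (hx : 0 < x) (hc : 0 < c) :
    c ^ q * (1 + q * (Real.log x - Real.log c)) ≤ x ^ q := by
  have h : x ^ q = c ^ q * Real.exp (q * (Real.log x - Real.log c)) := by
    rw [Real.rpow_def_of_pos hx, Real.rpow_def_of_pos hc, ← Real.exp_add]
    ring_nf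
  rw [h]
  gcongr
  linarith [Real.add_one_le_exp (q * (Real.log x - Real.log c))]

/-- Powers of the modulus of a zero-free analytic function are dominated by their Poisson
integral. -/
theorem norm_rpow_le_circleAverage_of_forall_ne_zero {g : ℂ → ℂ} {q : ℝ} {w : ℂ}
    (hg : AnalyticOnNhd ℂ g (closedBall 0 1)) (hg0 : ∀ z ∈ closedBall (0 : ℂ) 1, g z ≠ 0)
    (hw : w ∈ ball (0 : ℂ) 1) :
    ‖g w‖ ^ q ≤ Real.circleAverage (fun z => poissonKernel 0 w z * ‖g z‖ ^ q) 0 1 := by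
  have hlog := InnerProductSpace.HarmonicOnNhd.circleAverage_poissonKernel_smul
    (f := fun z => Real.log ‖g z‖) (c := 0) (R := 1)
    (fun x hx => (hg x hx).harmonicAt_log_norm (hg0 x hx)) hw
  have hcw : 0 < ‖g w‖ := norm_pos_iff.2 (hg0 w (ball_subset_closedBall hw))
  have hP := continuousOn_poissonKernel_zero hw
  have hgc : ContinuousOn g (sphere 0 1) := hg.continuousOn.mono sphere_subset_closedBall
  have hg0' : ∀ z ∈ sphere (0 : ℂ) 1, ‖g z‖ ≠ 0 := fun z hz =>
    norm_ne_zero_iff.2 (hg0 z (sphere_subset_closedBall hz))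
  have hL : ContinuousOn (fun z => Real.log ‖g z‖) (sphere (0 : ℂ) 1) := hgc.norm.log hg0'
  have i1 : CircleIntegrable (poissonKernel 0 w) 0 1 := hP.circleIntegrable zero_le_one
  have i2 : CircleIntegrable (poissonKernel 0 w • fun z => Real.log ‖g z‖) 0 1 :=
    (hP.smul hL).circleIntegrable zero_le_one
  have i3 : CircleIntegrable (fun z => poissonKernel 0 w z * ‖g z‖ ^ q) 0 1 :=
    (hP.mul (hgc.norm.rpow_const fun z hz => Or.inl (hg0' z hz))).circleIntegrable zero_le_one
  set c := ‖g w‖ with hc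
  -- Integrating the tangent line at log c against the kernel gives exactly c ^ q: the linear term
  -- drops out because log ‖g‖ is harmonic and its Poisson average is log c.
  have e : Real.circleAverage ((c ^ q * (1 - q * Real.log c)) • poissonKernel 0 w +
      (c ^ q * q) • (poissonKernel 0 w • fun z => Real.log ‖g z‖)) 0 1 = c ^ q := by
    rw [Real.circleAverage_add (i1.const_smul) (i2.const_smul), Real.circleAverage_smul,
      Real.circleAverage_smul, hlog, circleAverage_poissonKernel_zero hw]
    simp only [smul_eq_mul]
    ring
  rw [← e]
  refine Real.circleAverage_mono (i1.const_smul.add i2.const_smul) i3 fun z hz => ?_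
  rw [abs_one] at hz
  have h1 := rpow_mul_one_add_log_le (q := q) (norm_pos_iff.2 (hg0 z (sphere_subset_closedBall hz)))
    hcw
  have h2 := mul_le_mul_of_nonneg_left h1 (poissonKernel_zero_nonneg hw hz)
  simp only [Pi.add_apply, Pi.smul_apply, smul_eq_mul, Pi.mul_apply]
  linarith

/-! ### Removing zeros by Blaschke factors -/

theorem analyticOnNhd_dslope {f : ℂ → ℂ} {s : Set ℂ} (hf : AnalyticOnNhd ℂ f s) {z₀ : ℂ}
    (hz₀ : z₀ ∈ s) : AnalyticOnNhd ℂ (dslope f z₀) s := by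
  intro z hz
  by_cases h : z = z₀
  · subst h
    obtain ⟨p, hp⟩ := hf z hz
    exact ⟨_, hp.has_fpower_series_dslope_fslope⟩
  · have h1 : AnalyticAt ℂ (fun z => (z - z₀)⁻¹ * (f z - f z₀)) z :=
      ((analyticAt_id.sub analyticAt_const).inv (sub_ne_zero.2 h)).mul
        ((hf z hz).sub analyticAt_const)
    refine h1.congr ?_
    filter_upwards [dslope_eventuallyEq_slope_of_ne f h] with y hy
    rw [hy, slope_def_module, smul_eq_mul]

open ComplexConjugate in
-- This identity shows both that a Blaschke factor is unimodular on the circle and by how much its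
-- modulus falls short of 1 inside.
theorem norm_one_sub_conj_mul_sq (a z : ℂ) :
    ‖1 - conj a * z‖ ^ 2 - ‖z - a‖ ^ 2 = (1 - ‖a‖ ^ 2) * (1 - ‖z‖ ^ 2) := by
  simp only [← Complex.normSq_eq_norm_sq, Complex.normSq_apply]
  simp
  ring

open ComplexConjugate in
/-- Division by a Blaschke factor. -/
theorem exists_analyticOnNhd_div_blaschkeFactor {f : ℂ → ℂ}
    (hf : AnalyticOnNhd ℂ f (closedBall 0 1)) {a : ℂ} (ha : a ∈ ball (0 : ℂ) 1) (hfa : f a = 0) :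
    ∃ g : ℂ → ℂ, AnalyticOnNhd ℂ g (closedBall 0 1) ∧
      ∀ z, f z * (1 - conj a * z) = (z - a) * g z := by
  refine ⟨fun z => dslope f a z * (1 - conj a * z), ?_, fun z => ?_⟩
  · intro z hz
    exact (analyticOnNhd_dslope hf (ball_subset_closedBall ha) z hz).mul (by fun_prop)
  · have h := sub_smul_dslope f a z
    rw [smul_eq_mul, hfa, sub_zero] at h
    rw [← h]; ring

open ComplexConjugate in
/-- Powers of the modulus of an analytic function without zeros on the circle are dominated by
their Poisson integral. -/
theorem norm_rpow_le_circleAverage_of_forall_sphere_ne_zero {f : ℂ → ℂ} {q : ℝ} (hq : 0 < q)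
    {w : ℂ} (hf : AnalyticOnNhd ℂ f (closedBall 0 1)) (hf0 : ∀ z ∈ sphere (0 : ℂ) 1, f z ≠ 0)
    (hw : w ∈ ball (0 : ℂ) 1) :
    ‖f w‖ ^ q ≤ Real.circleAverage (fun z => poissonKernel 0 w z * ‖f z‖ ^ q) 0 1 := by
  have hP := continuousOn_poissonKernel_zero hw
  by_cases hfw : f w = 0
  · rw [hfw, norm_zero, Real.zero_rpow hq.ne']
    refine Real.circleAverage_nonneg_of_nonneg fun z hz => ?_
    rw [abs_one] at hz
    exact mul_nonneg (poissonKernel_zero_nonneg hw hz) (by positivity)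
  -- the zeros lie in a smaller disc
  obtain ⟨ρ, hρ1, hρw, hρ⟩ : ∃ ρ < 1, ‖w‖ ≤ ρ ∧ ∀ z ∈ closedBall (0 : ℂ) 1, f z = 0 → ‖z‖ ≤ ρ := by
    have hZ : IsCompact {z ∈ closedBall (0 : ℂ) 1 | f z = 0} := by
      refine (isCompact_closedBall (0 : ℂ) 1).of_isClosed_subset ?_ (sep_subset _ _)
      exact hf.continuousOn.preimage_isClosed_of_isClosed isClosed_closedBall isClosed_singleton
    rcases ({z ∈ closedBall (0 : ℂ) 1 | f z = 0}).eq_empty_or_nonempty with h | h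
    · refine ⟨‖w‖, mem_ball_zero_iff.1 hw, le_rfl, fun z hz hz0 => ?_⟩
      exact absurd (show z ∈ {z ∈ closedBall (0 : ℂ) 1 | f z = 0} from ⟨hz, hz0⟩)
        (h ▸ notMem_empty z)
    · obtain ⟨z₀, hz₀, hmax⟩ := hZ.exists_isMaxOn h continuous_norm.continuousOn
      have hz1 : ‖z₀‖ < 1 := by
        refine lt_of_le_of_ne (mem_closedBall_zero_iff.1 hz₀.1) fun h => ?_
        exact hf0 z₀ (mem_sphere_zero_iff_norm.2 h) hz₀.2
      exact ⟨max ‖w‖ ‖z₀‖, max_lt (mem_ball_zero_iff.1 hw) hz1, le_max_left _ _,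
        fun z hz hz0 => (hmax ⟨hz, hz0⟩).trans (le_max_right _ _)⟩
  have hρ0 : 0 ≤ ρ := (norm_nonneg w).trans hρw
  obtain ⟨M, hM⟩ := (isCompact_sphere (0 : ℂ) 1).exists_bound_of_continuousOn
    (hf.continuousOn.mono sphere_subset_closedBall)
  -- For a zero a with ‖a‖ ≤ ρ, the product (1 - ‖a‖²)(1 - ‖w‖²) is at least (1 - ρ²)² and ‖1 - conj
  -- a * w‖² is at most 4, so the squared Blaschke factor at w is at most 1 - δ.
  set δ : ℝ := (1 - ρ ^ 2) ^ 2 / 4 with hδ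
  have hρ2 : ρ ^ 2 < 1 := by nlinarith
  have hδ0 : 0 < δ := by have : 0 < 1 - ρ ^ 2 := by linarith
                         positivity
  -- each division increases the value at `w` by a definite factor
  have key : ∀ n : ℕ, ∀ g : ℂ → ℂ, AnalyticOnNhd ℂ g (closedBall 0 1) →
      (∀ z ∈ sphere (0 : ℂ) 1, ‖g z‖ = ‖f z‖) →
      (∀ z ∈ closedBall (0 : ℂ) 1, g z = 0 → f z = 0) →
      (M ^ 2 + 1) * (1 - δ) ^ n ≤ ‖g w‖ ^ 2 →
      ‖g w‖ ^ q ≤ Real.circleAverage (fun z => poissonKernel 0 w z * ‖f z‖ ^ q) 0 1 := by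
    intro n
    induction n with
    | zero =>
      intro g hg hgs _ hgw
      -- With no divisions left, ‖g w‖² ≥ M² + 1 contradicts the maximum principle. Thus n bounds
      -- the number of zeros that can still be removed.
      exfalso
      have h1 : ‖g w‖ ≤ M := by
        refine Complex.norm_le_of_forall_mem_frontier_norm_le (U := ball 0 1) isBounded_ball
          ?_ (fun z hz => ?_) (subset_closure hw)
        · refine ⟨hg.differentiableOn.mono ball_subset_closedBall, ?_⟩
          rw [closure_ball _ one_ne_zero]; exact hg.continuousOn
        · rw [frontier_ball _ one_ne_zero] at hz
          rw [hgs z hz]; exact hM z hz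
      nlinarith [norm_nonneg (g w)]
    | succ n ih =>
      intro g hg hgs hgz hgw
      by_cases h0 : ∃ a ∈ closedBall (0 : ℂ) 1, g a = 0
      · obtain ⟨a, ha, hga⟩ := h0
        have haρ := hρ a ha (hgz a ha hga)
        have ha1 : a ∈ ball (0 : ℂ) 1 := mem_ball_zero_iff.2 (haρ.trans_lt hρ1)
        obtain ⟨h, hh, hgh⟩ := exists_analyticOnNhd_div_blaschkeFactor hg ha1 hga
        have hpos : ∀ z ∈ closedBall (0 : ℂ) 1, 0 < ‖1 - conj a * z‖ := by
          intro z hz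
          rw [norm_pos_iff, sub_ne_zero]
          intro h1
          have h2 := congrArg norm h1
          rw [norm_one, norm_mul, Complex.norm_conj] at h2
          nlinarith [norm_nonneg a, norm_nonneg z, mem_closedBall_zero_iff.1 hz]
        have hle : ‖g w‖ ^ 2 ≤ (1 - δ) * ‖h w‖ ^ 2 := by
          have e1 := norm_one_sub_conj_mul_sq a w
          have e2 := congrArg norm (hgh w)
          rw [norm_mul, norm_mul] at e2
          have hD := hpos w (ball_subset_closedBall hw)
          have hD2 : ‖1 - conj a * w‖ ≤ 2 := by
            refine (norm_sub_le _ _).trans ?_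
            rw [norm_one, norm_mul, Complex.norm_conj]
            nlinarith [norm_nonneg a, norm_nonneg w]
          have hA : 1 - ρ ^ 2 ≤ 1 - ‖a‖ ^ 2 := by nlinarith [norm_nonneg a]
          have hB : 1 - ρ ^ 2 ≤ 1 - ‖w‖ ^ 2 := by nlinarith [norm_nonneg w]
          have hAB : (1 - ρ ^ 2) * (1 - ρ ^ 2) ≤ (1 - ‖a‖ ^ 2) * (1 - ‖w‖ ^ 2) :=
            mul_le_mul hA hB (by linarith) (by linarith)
          have hD4 : ‖1 - conj a * w‖ ^ 2 ≤ 4 := by nlinarith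
          have h3 : ‖w - a‖ ^ 2 ≤ (1 - δ) * ‖1 - conj a * w‖ ^ 2 := by
            have : δ * ‖1 - conj a * w‖ ^ 2 ≤ δ * 4 := by gcongr
            rw [hδ] at this ⊢
            nlinarith
          have h4 : ‖g w‖ ^ 2 * ‖1 - conj a * w‖ ^ 2 = ‖w - a‖ ^ 2 * ‖h w‖ ^ 2 := by
            rw [← mul_pow, e2, mul_pow]
          have h5 : ‖g w‖ ^ 2 * ‖1 - conj a * w‖ ^ 2 ≤
              ((1 - δ) * ‖h w‖ ^ 2) * ‖1 - conj a * w‖ ^ 2 := by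
            rw [h4]
            nlinarith [mul_le_mul_of_nonneg_right h3 (sq_nonneg ‖h w‖)]
          exact le_of_mul_le_mul_right h5 (by positivity)
        have hδ1 : δ < 1 := by rw [hδ]; nlinarith
        have hhw : (M ^ 2 + 1) * (1 - δ) ^ n ≤ ‖h w‖ ^ 2 := by
          have : (1 - δ) * ((M ^ 2 + 1) * (1 - δ) ^ n) ≤ (1 - δ) * ‖h w‖ ^ 2 := by
            refine le_trans (le_of_eq ?_) (hgw.trans hle)
            ring
          exact le_of_mul_le_mul_left this (by linarith)
        have hgw_le : ‖g w‖ ≤ ‖h w‖ := by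
          refine (sq_le_sq₀ (norm_nonneg _) (norm_nonneg _)).1 (hle.trans ?_)
          nlinarith [sq_nonneg ‖h w‖]
        refine le_trans ?_ (ih h hh (fun z hz => ?_) (fun z hz hz0 => ?_) hhw)
        · exact Real.rpow_le_rpow (norm_nonneg _) hgw_le hq.le
        · have e1 := norm_one_sub_conj_mul_sq a z
          have e2 := congrArg norm (hgh z)
          rw [norm_mul, norm_mul] at e2
          rw [mem_sphere_zero_iff_norm.1 hz, one_pow, sub_self, mul_zero, sub_eq_zero] at e1
          have e3 := (sq_eq_sq₀ (norm_nonneg _) (norm_nonneg _)).1 e1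
          rw [← e3, mul_comm] at e2
          rw [← hgs z hz]
          exact (mul_left_cancel₀ (hpos z (sphere_subset_closedBall hz)).ne' e2).symm
        · refine hgz z hz ?_
          have e2 := hgh z
          rw [hz0, mul_zero] at e2
          exact (mul_eq_zero.1 e2).resolve_right (norm_pos_iff.1 (hpos z hz))
      · push Not at h0
        refine (norm_rpow_le_circleAverage_of_forall_ne_zero hg h0 hw).trans (le_of_eq ?_)
        refine Real.circleAverage_congr_sphere fun z hz => ?_
        rw [abs_one] at hz
        simp only [hgs z hz]
  have hδ1 : |1 - δ| < 1 := by
    rw [abs_lt]; constructor <;> [(rw [hδ]; nlinarith); linarith]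
  -- Since f w ≠ 0, a large n makes the starting hypothesis of the induction true.
  have ht : Tendsto (fun n : ℕ => (M ^ 2 + 1) * (1 - δ) ^ n) atTop (𝓝 0) := by
    simpa using (tendsto_pow_atTop_nhds_zero_of_abs_lt_one hδ1).const_mul (M ^ 2 + 1)
  have hfw2 : 0 < ‖f w‖ ^ 2 := by have := norm_pos_iff.2 hfw; positivity
  obtain ⟨n, hn⟩ := (ht.eventually (gt_mem_nhds hfw2)).exists
  exact key n f hf (fun _ _ => rfl) (fun _ _ h => h) hn.le

/-! ### The Poisson kernel in the angle variable -/

/-- Lebesgue measure on one period of the angle. -/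
noncomputable abbrev angleMeasure : Measure ℝ := volume.restrict (Ioc 0 (2 * Real.pi))

/-- The Poisson kernel of the unit disc, as a function of the angle. -/
noncomputable def poissonAngle (w : ℂ) (θ : ℝ) : ℝ := poissonKernel 0 w (circleMap 0 1 θ)

theorem circleAverage_eq_integral_angleMeasure (g : ℂ → ℝ) :
    Real.circleAverage g 0 1 = (2 * Real.pi)⁻¹ * ∫ θ, g (circleMap 0 1 θ) ∂angleMeasure := by
  rw [Real.circleAverage_def, intervalIntegral.integral_of_le Real.two_pi_pos.le, smul_eq_mul]

theorem circleMap_one_mem_sphere (θ : ℝ) : circleMap 0 1 θ ∈ sphere (0 : ℂ) 1 := by simp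

theorem poissonAngle_nonneg {w : ℂ} (hw : w ∈ ball (0 : ℂ) 1) (θ : ℝ) : 0 ≤ poissonAngle w θ :=
  poissonKernel_zero_nonneg hw (circleMap_one_mem_sphere θ)

theorem continuous_poissonAngle {w : ℂ} (hw : w ∈ ball (0 : ℂ) 1) :
    Continuous (poissonAngle w) :=
  (continuousOn_poissonKernel_zero hw).comp_continuous (continuous_circleMap 0 1)
    circleMap_one_mem_sphere

theorem integral_poissonAngle {w : ℂ} (hw : w ∈ ball (0 : ℂ) 1) :
    (2 * Real.pi)⁻¹ * ∫ θ, poissonAngle w θ ∂angleMeasure = 1 := by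
  rw [← circleAverage_poissonKernel_zero hw, circleAverage_eq_integral_angleMeasure]
  rfl

/-- The kernel is the real part of (z + w) / (z - w), and the difference of two such quotients is
explicit. The bound is uniform in the angle, so nearby poles can be exchanged under the integral. -/
theorem abs_poissonAngle_sub_le {ρ : ℝ} (hρ : ρ < 1) {w₁ w₂ : ℂ} (h₁ : ‖w₁‖ ≤ ρ) (h₂ : ‖w₂‖ ≤ ρ)
    (θ : ℝ) : |poissonAngle w₁ θ - poissonAngle w₂ θ| ≤ 2 * ‖w₁ - w₂‖ / (1 - ρ) ^ 2 := by
  set z := circleMap 0 1 θ with hz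
  have hz1 : ‖z‖ = 1 := by simp [hz]
  have hd : ∀ w : ℂ, ‖w‖ ≤ ρ → 1 - ρ ≤ ‖z - w‖ := fun w hw => by
    have := norm_sub_norm_le z w
    linarith
  have h0 : ∀ w : ℂ, ‖w‖ ≤ ρ → z - w ≠ 0 := fun w hw => by
    rw [← norm_pos_iff]; linarith [hd w hw]
  have e : (z + w₁) / (z - w₁) - (z + w₂) / (z - w₂) =
      2 * z * (w₁ - w₂) / ((z - w₁) * (z - w₂)) := by
    have := h0 w₁ h₁
    have := h0 w₂ h₂
    field_simp
    ring
  have hP : ∀ w : ℂ, poissonAngle w θ = ((z + w) / (z - w)).re := fun w => by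
    rw [poissonAngle, poissonKernel_eq_re_herglotzRieszKernel]
    simp [herglotzRieszKernel_def, hz]
  rw [hP, hP, ← Complex.sub_re, e]
  refine (Complex.abs_re_le_norm _).trans ?_
  rw [norm_div, norm_mul, norm_mul, norm_mul, hz1]
  simp only [Complex.norm_ofNat, mul_one]
  have hρ' : 0 < 1 - ρ := by linarith
  have := mul_le_mul (hd w₁ h₁) (hd w₂ h₂) hρ'.le (norm_nonneg _)
  rw [← sq] at this
  gcongr

theorem abs_poissonAngle_le {w : ℂ} (hw : w ∈ ball (0 : ℂ) 1) :
    ∃ C, ∀ θ, |poissonAngle w θ| ≤ C := by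
  refine ⟨1 + 2 * ‖w - 0‖ / (1 - ‖w‖) ^ 2, fun θ => ?_⟩
  have h0 : poissonAngle 0 θ = 1 := by simp [poissonAngle, poissonKernel_def]
  have h1 := abs_poissonAngle_sub_le (mem_ball_zero_iff.1 hw) (w₁ := w) (w₂ := 0) le_rfl (by simp) θ
  have h2 := abs_add_le (poissonAngle w θ - poissonAngle 0 θ) (poissonAngle 0 θ)
  rw [sub_add_cancel, h0, abs_one] at h2
  rw [h0] at h1
  linarith

theorem memLp_poissonAngle {w : ℂ} (hw : w ∈ ball (0 : ℂ) 1) (q : ENNReal) :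
    MemLp (poissonAngle w) q angleMeasure := by
  obtain ⟨C, hC⟩ := abs_poissonAngle_le hw
  exact MemLp.of_bound (continuous_poissonAngle hw).aestronglyMeasurable C
    (Eventually.of_forall hC)

theorem integrable_poissonAngle_mul {w : ℂ} (hw : w ∈ ball (0 : ℂ) 1) {g : ℝ → ℝ}
    (hg : Integrable g angleMeasure) :
    Integrable (fun θ => poissonAngle w θ * g θ) angleMeasure := by
  obtain ⟨C, hC⟩ := abs_poissonAngle_le hw
  exact hg.bdd_mul (continuous_poissonAngle hw).aestronglyMeasurable (Eventually.of_forall hC)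

/-! ### Poisson majorants of functions with bounded means -/

theorem circleMap_zero_eq_mul (r θ : ℝ) : circleMap 0 r θ = r * circleMap 0 1 θ := by
  simp [circleMap]

/-- The dilation z ↦ F (r z) is analytic on the closed disc, with no zeros on its boundary. -/
theorem norm_rpow_le_integral_poissonAngle {F : ℂ → ℂ} (hF : DifferentiableOn ℂ F (ball 0 1))
    {q : ℝ} (hq : 0 < q) {r : ℝ} (hr : r ∈ Ioo (0 : ℝ) 1) (h0 : ∀ z, ‖z‖ = r → F z ≠ 0)
    {w : ℂ} (hw : w ∈ ball (0 : ℂ) 1) :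
    ‖F (r * w)‖ ^ q ≤ (2 * Real.pi)⁻¹ *
      ∫ θ, poissonAngle w θ * ‖F (circleMap 0 r θ)‖ ^ q ∂angleMeasure := by
  have hf : AnalyticOnNhd ℂ (fun z => F (r * z)) (closedBall 0 1) := by
    intro z hz
    have hz1 : (r : ℂ) * z ∈ ball (0 : ℂ) 1 := by
      rw [mem_closedBall_zero_iff] at hz
      rw [mem_ball_zero_iff, norm_mul, Complex.norm_real, Real.norm_of_nonneg hr.1.le]
      nlinarith [hr.1, hr.2, norm_nonneg z]
    exact (hF.analyticOnNhd isOpen_ball _ hz1).fun_comp (by fun_prop)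
  have h := norm_rpow_le_circleAverage_of_forall_sphere_ne_zero hq hf (fun z hz => h0 _ ?_) hw
  · rw [circleAverage_eq_integral_angleMeasure] at h
    simpa only [poissonAngle, circleMap_zero_eq_mul r] using h
  · rw [mem_sphere_zero_iff_norm] at hz
    rw [norm_mul, Complex.norm_real, Real.norm_of_nonneg hr.1.le, hz, mul_one]

/-- A set all of whose points are isolated from the zeros of `f` contains countably many zeros. -/
theorem countable_setOf_eq_zero {X E : Type*} [TopologicalSpace X] [SecondCountableTopology X]
    [Zero E] {f : X → E} {s : Set X} (h : ∀ x ∈ s, ∀ᶠ y in 𝓝[≠] x, f y ≠ 0) :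
    {x ∈ s | f x = 0}.Countable := by
  -- Lindelöf: each zero has a neighbourhood in which it is the only zero, and countably many of
  -- these cover all zeros.
  obtain ⟨t, -, htc, ht⟩ := TopologicalSpace.countable_cover_nhdsWithin
    (s := {x ∈ s | f x = 0}) (f := fun x => insert x {y | f y ≠ 0}) fun x hx => by
      refine mem_nhdsWithin_of_mem_nhds ?_
      rw [insert_mem_nhds_iff]
      exact h x hx.1
  refine htc.mono fun x hx => ?_
  obtain ⟨y, hy, hxy⟩ := mem_iUnion₂.1 (ht hx)
  rcases hxy with rfl | hxy
  · exact hy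
  · exact absurd hx.2 hxy

/-- Every circle of radius `< 1` is approximated from outside by circles free of zeros. -/
theorem neBot_nhdsWithin_zeroFree_radii {F : ℂ → ℂ} (hF : DifferentiableOn ℂ F (ball 0 1))
    (hF0 : ∃ z ∈ ball (0 : ℂ) 1, F z ≠ 0) :
    (𝓝[{r | r ∈ Ioo (0 : ℝ) 1 ∧ ∀ z, ‖z‖ = r → F z ≠ 0}] 1).NeBot := by
  have hA := hF.analyticOnNhd isOpen_ball
  have hc : {z ∈ ball (0 : ℂ) 1 | F z = 0}.Countable := by
    refine countable_setOf_eq_zero fun x hx => ?_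
    rcases (hA x hx).eventually_eq_zero_or_eventually_ne_zero with h | h
    · exfalso
      obtain ⟨z, hz, hz0⟩ := hF0
      exact hz0 (hA.eqOn_zero_of_preconnected_of_eventuallyEq_zero
        (convex_ball 0 1).isPreconnected hx h hz)
    · exact h
  rw [← mem_closure_iff_nhdsWithin_neBot, Metric.mem_closure_iff]
  intro ε hε
  -- Countably many zeros exclude only countably many radii.
  have hd := (hc.image norm).dense_compl ℝ
  obtain ⟨r, hr, hr1⟩ := hd.inter_open_nonempty (Ioo (max 0 (1 - ε)) 1) isOpen_Ioo
    (nonempty_Ioo.2 (max_lt one_pos (by linarith)))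
  have h1 := (max_lt_iff.1 hr.1)
  refine ⟨r, ⟨⟨h1.1, hr.2⟩, fun z hz hz0 => hr1 ⟨z, ⟨?_, hz0⟩, hz⟩⟩, ?_⟩
  · rw [mem_ball_zero_iff, hz]; exact hr.2
  · rw [Real.dist_eq, abs_lt]; constructor <;> linarith [hr.2]

/-- Weak compactness of bounded families in a Hilbert space, along an ultrafilter. -/
theorem exists_tendsto_inner_of_bounded {ι H : Type*} [NormedAddCommGroup H]
    [InnerProductSpace ℝ H] [CompleteSpace H] (𝒰 : Ultrafilter ι) {x : ι → H} {C : ℝ}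
    (hC : ∀ i, ‖x i‖ ≤ C) :
    ∃ g : H, ∀ h : H, Tendsto (fun i => inner ℝ (x i) h) 𝒰 (𝓝 (inner ℝ g h)) := by
  let y : ι → WeakDual ℝ H := fun i => StrongDual.toWeakDual (InnerProductSpace.toDual ℝ H (x i))
  -- Banach–Alaoglu, read in the Hilbert space through the Riesz isomorphism.
  have hK := WeakDual.isCompact_closedBall (0 : StrongDual ℝ H) C
  have hy : ∀ i, y i ∈ WeakDual.toStrongDual ⁻¹' closedBall (0 : StrongDual ℝ H) C := fun i => by
    rw [mem_preimage, mem_closedBall_zero_iff]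
    exact ((InnerProductSpace.toDual ℝ H).norm_map (x i)).trans_le (hC i)
  obtain ⟨l, -, hl⟩ := isCompact_iff_ultrafilter_le_nhds.1 hK (𝒰.map y)
    (le_principal_iff.2 (Ultrafilter.mem_map.2 (Eventually.of_forall hy)))
  refine ⟨(InnerProductSpace.toDual ℝ H).symm (WeakDual.toStrongDual l), fun h => ?_⟩
  rw [InnerProductSpace.toDual_symm_apply]
  exact ((WeakDual.eval_continuous h).tendsto l).comp hl

/-- Jensen's inequality for the square: the normalised kernel is a probability density, and the
variance of g under it is nonnegative. -/
theorem sq_integral_poissonAngle_mul_le {w : ℂ} (hw : w ∈ ball (0 : ℂ) 1) {g : ℝ → ℝ}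
    (hg : MemLp g 2 angleMeasure) :
    ((2 * Real.pi)⁻¹ * ∫ θ, poissonAngle w θ * g θ ∂angleMeasure) ^ 2 ≤
      (2 * Real.pi)⁻¹ * ∫ θ, poissonAngle w θ * g θ ^ 2 ∂angleMeasure := by
  set m := (2 * Real.pi)⁻¹ * ∫ θ, poissonAngle w θ * g θ ∂angleMeasure with hm
  have i0 : Integrable (poissonAngle w) angleMeasure := (memLp_poissonAngle hw 1).integrable le_rfl
  have i1 := integrable_poissonAngle_mul hw (hg.integrable one_le_two)
  have i2 := integrable_poissonAngle_mul hw hg.integrable_sq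
  have h : 0 ≤ ∫ θ, poissonAngle w θ * (g θ - m) ^ 2 ∂angleMeasure :=
    integral_nonneg fun θ => mul_nonneg (poissonAngle_nonneg hw θ) (sq_nonneg _)
  have e : ∫ θ, poissonAngle w θ * (g θ - m) ^ 2 ∂angleMeasure =
      ∫ θ, poissonAngle w θ * g θ ^ 2 ∂angleMeasure -
        2 * m * ∫ θ, poissonAngle w θ * g θ ∂angleMeasure +
        m ^ 2 * ∫ θ, poissonAngle w θ ∂angleMeasure := by
    rw [← integral_const_mul, ← integral_const_mul, ← integral_sub i2 (i1.const_mul _)]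
    refine Eq.trans ?_ (integral_add (i2.sub (i1.const_mul _)) (i0.const_mul _))
    refine integral_congr_ae (Eventually.of_forall fun θ => ?_)
    simp only
    ring
  have hpi : 0 ≤ (2 * Real.pi)⁻¹ := by positivity
  have h1 := mul_nonneg hpi h
  have h2 := integral_poissonAngle hw
  rw [e] at h1
  have h3 : (2 * Real.pi)⁻¹ * (∫ θ, poissonAngle w θ * g θ ^ 2 ∂angleMeasure -
        2 * m * ∫ θ, poissonAngle w θ * g θ ∂angleMeasure +
        m ^ 2 * ∫ θ, poissonAngle w θ ∂angleMeasure) =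
      (2 * Real.pi)⁻¹ * ∫ θ, poissonAngle w θ * g θ ^ 2 ∂angleMeasure - 2 * m * m + m ^ 2 * 1 := by
    rw [← h2]
    nth_rewrite 4 [hm]
    ring
  rw [h3] at h1
  nlinarith

/-- An analytic function with bounded `p`-means is dominated, to the power `p`, by the Poisson
integral of an integrable function. -/
theorem exists_poisson_majorant {F : ℂ → ℂ} (hF : DifferentiableOn ℂ F (ball 0 1)) {p : ℝ}
    (hp : 0 < p) {C : ℝ}
    (hC : ∀ r ∈ Ioo (0 : ℝ) 1, ∫ θ, ‖F (circleMap 0 r θ)‖ ^ p ∂angleMeasure ≤ C) :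
    ∃ G : ℝ → ℝ, Integrable G angleMeasure ∧ ∀ w ∈ ball (0 : ℂ) 1,
      ‖F w‖ ^ p ≤ (2 * Real.pi)⁻¹ * ∫ θ, poissonAngle w θ * G θ ∂angleMeasure := by
  by_cases hF0 : ∃ z ∈ ball (0 : ℂ) 1, F z ≠ 0
  swap
  · push Not at hF0
    refine ⟨0, integrable_zero _ _ _, fun w hw => ?_⟩
    simp [hF0 w hw, Real.zero_rpow hp.ne']
  have hne := neBot_nhdsWithin_zeroFree_radii hF hF0
  set s := {r | r ∈ Ioo (0 : ℝ) 1 ∧ ∀ z, ‖z‖ = r → F z ≠ 0} with hs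
  set 𝒰 := Ultrafilter.of (𝓝[s] 1) with h𝒰
  have h𝒰s : ∀ᶠ r in (𝒰 : Filter ℝ), r ∈ s := (Ultrafilter.of_le _) self_mem_nhdsWithin
  have h𝒰1 : Tendsto id (𝒰 : Filter ℝ) (𝓝 1) :=
    (Ultrafilter.of_le (𝓝[s] (1 : ℝ))).trans nhdsWithin_le_nhds
  -- The exponent p / 2 turns the bound on p-means into a bound in L², where bounded families have
  -- weak limits.
  let v : ℝ → ℝ → ℝ := fun r θ => ‖F (circleMap 0 r θ)‖ ^ (p / 2)
  have hvc : ∀ r ∈ Ioo (0 : ℝ) 1, Continuous (v r) := fun r hr => by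
    refine Continuous.rpow_const (hF.continuousOn.comp_continuous (continuous_circleMap 0 r)
      fun θ => ?_).norm fun _ => Or.inr (by positivity)
    simp [abs_of_pos hr.1, hr.2]
  have hvL : ∀ r ∈ Ioo (0 : ℝ) 1, MemLp (v r) 2 angleMeasure := fun r hr => by
    obtain ⟨B, hB⟩ := (isCompact_Icc (a := (0 : ℝ))
      (b := 2 * Real.pi)).exists_bound_of_continuousOn (hvc r hr).continuousOn
    refine MemLp.of_bound (hvc r hr).aestronglyMeasurable B ?_
    exact (ae_restrict_iff' measurableSet_Ioc).2
      (Eventually.of_forall fun θ hθ => hB θ (Ioc_subset_Icc_self hθ))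
  have hvsq : ∀ r θ, v r θ ^ 2 = ‖F (circleMap 0 r θ)‖ ^ p := fun r θ => by
    rw [← Real.rpow_natCast, ← Real.rpow_mul (norm_nonneg _)]
    congr 1
    push_cast; ring
  classical
  -- The value 0 at other radii makes the norm bound hold for every index.
  let u : ℝ → Lp ℝ 2 angleMeasure := fun r =>
    if h : r ∈ Ioo (0 : ℝ) 1 then (hvL r h).toLp (v r) else 0
  have hu : ∀ r, ‖u r‖ ≤ √C := fun r => by
    by_cases h : r ∈ Ioo (0 : ℝ) 1
    · refine Real.le_sqrt_of_sq_le ?_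
      rw [← real_inner_self_eq_norm_sq, L2.inner_def]
      refine le_trans (le_of_eq ?_) (hC r h)
      refine integral_congr_ae ?_
      filter_upwards [(hvL r h).coeFn_toLp] with θ hθ
      simp only [u, dif_pos h, hθ, ← hvsq]
      simp
    · simp only [u, dif_neg h, norm_zero]; positivity
  obtain ⟨g, hg⟩ := exists_tendsto_inner_of_bounded 𝒰 hu
  have hgL : MemLp g 2 angleMeasure := Lp.memLp g
  refine ⟨fun θ => g θ ^ 2, hgL.integrable_sq, fun w hw => ?_⟩
  refine le_trans ?_ (sq_integral_poissonAngle_mul_le hw hgL)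
  have hFw : ‖F w‖ ^ p = (‖F w‖ ^ (p / 2)) ^ 2 := by
    rw [← Real.rpow_natCast, ← Real.rpow_mul (norm_nonneg _)]
    congr 1
    push_cast; ring
  rw [hFw]
  refine pow_le_pow_left₀ (by positivity) ?_ 2
  -- pass to the limit in the Poisson inequality on circles without zeros
  have hlim := (hg ((memLp_poissonAngle hw 2).toLp _)).const_mul (2 * Real.pi)⁻¹
  have einner : ∀ f : Lp ℝ 2 angleMeasure, inner ℝ f ((memLp_poissonAngle hw 2).toLp _) =
      ∫ θ, poissonAngle w θ * f θ ∂angleMeasure := fun f => by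
    rw [L2.inner_def]
    refine integral_congr_ae ?_
    filter_upwards [(memLp_poissonAngle hw 2).coeFn_toLp] with θ hθ
    simp [hθ]
  rw [einner] at hlim
  obtain ⟨ρ, hwρ, hρ1⟩ := exists_between (mem_ball_zero_iff.1 hw)
  have hρ0 : 0 < ρ := (norm_nonneg w).trans_lt hwρ
  -- The Poisson inequality on radius r bounds F w by the kernel with pole w / r. Replacing the pole
  -- by w costs at most this error: the Lipschitz bound times ∫ v ≤ 2π + C, from v ≤ 1 + v².
  have herr : Tendsto (fun r : ℝ => (2 * Real.pi)⁻¹ *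
      (2 * ‖w / r - w‖ / (1 - ρ) ^ 2 * (2 * Real.pi + C))) 𝒰 (𝓝 0) := by
    have : ContinuousAt (fun r : ℝ => (2 * Real.pi)⁻¹ *
      (2 * ‖w / r - w‖ / (1 - ρ) ^ 2 * (2 * Real.pi + C))) 1 := by
      fun_prop (disch := simp)
    have h1 := this.tendsto.comp h𝒰1
    simpa using h1
  have hsum := hlim.add herr
  rw [add_zero] at hsum
  refine ge_of_tendsto hsum ?_
  have hwr : ∀ᶠ r in (𝒰 : Filter ℝ), ‖w‖ / ρ < r :=
    h𝒰1.eventually (lt_mem_nhds (by rw [div_lt_one hρ0]; exact hwρ))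
  filter_upwards [h𝒰s, hwr] with r hr hrw
  have hr0 := hr.1.1
  have hwr1 : ‖w / r‖ ≤ ρ := by
    rw [norm_div, Complex.norm_real, Real.norm_of_nonneg hr0.le, div_le_iff₀ hr0]
    rw [div_lt_iff₀ hρ0] at hrw
    linarith
  have hwr2 : w / r ∈ ball (0 : ℂ) 1 := mem_ball_zero_iff.2 (hwr1.trans_lt hρ1)
  have h1 := norm_rpow_le_integral_poissonAngle hF (half_pos hp) hr.1 hr.2 hwr2
  have hrc : (r : ℂ) ≠ 0 := Complex.ofReal_ne_zero.2 hr0.ne'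
  rw [mul_div_cancel₀ _ hrc] at h1
  refine h1.trans ?_
  rw [← mul_add, einner]
  refine mul_le_mul_of_nonneg_left ?_ (by positivity)
  have ev : ∫ θ, poissonAngle w θ * u r θ ∂angleMeasure =
      ∫ θ, poissonAngle w θ * v r θ ∂angleMeasure := by
    refine integral_congr_ae ?_
    filter_upwards [(hvL r hr.1).coeFn_toLp] with θ hθ
    simp only [u, dif_pos hr.1, hθ]
  rw [ev]
  have iv : Integrable (v r) angleMeasure := (hvL r hr.1).integrable one_le_two
  have iv2 : Integrable (fun θ => v r θ ^ 2) angleMeasure := (hvL r hr.1).integrable_sq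
  have hI : ∫ θ, v r θ ∂angleMeasure ≤ 2 * Real.pi + C := by
    have h3 : ∫ θ, v r θ ∂angleMeasure ≤ ∫ θ, (1 + v r θ ^ 2) ∂angleMeasure :=
      integral_mono iv ((integrable_const 1).add iv2) fun θ => by
        simp only; nlinarith [sq_nonneg (v r θ - 1)]
    rw [integral_add (integrable_const 1) iv2] at h3
    have h4 := hC r hr.1
    simp only [← hvsq] at h4
    have h5 : ∫ _ : ℝ, (1 : ℝ) ∂angleMeasure = 2 * Real.pi := by
      simp [measureReal_def, Real.pi_pos.le]
    linarith
  have h6 : ∫ θ, poissonAngle (w / r) θ * v r θ ∂angleMeasure ≤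
      ∫ θ, (poissonAngle w θ * v r θ + 2 * ‖w / r - w‖ / (1 - ρ) ^ 2 * v r θ) ∂angleMeasure := by
    refine integral_mono (integrable_poissonAngle_mul hwr2 iv)
      ((integrable_poissonAngle_mul hw iv).add (iv.const_mul _)) fun θ => ?_
    have h7 := (abs_le.1 (abs_poissonAngle_sub_le hρ1 hwr1 hwρ.le θ)).2
    have h8 : 0 ≤ v r θ := by positivity
    nlinarith
  rw [integral_add (integrable_poissonAngle_mul hw iv) (iv.const_mul _), integral_const_mul] at h6
  have hρ' : 0 < 1 - ρ := by linarith
  exact h6.trans (by gcongr)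

/-! ### Poisson means on circles and their boundary limits -/

theorem circleMap_mem_ball {s : ℝ} (hs : s ∈ Ioo (0 : ℝ) 1) (t : ℝ) :
    circleMap 0 s t ∈ ball (0 : ℂ) 1 := by
  simp [abs_of_pos hs.1, hs.2]

theorem poissonAngle_circleMap (s t θ : ℝ) :
    poissonAngle (circleMap 0 s t) θ =
      (1 - s ^ 2) / ‖circleMap 0 1 θ - circleMap 0 s t‖ ^ 2 := by
  simp [poissonAngle, poissonKernel_def]

theorem norm_circleMap_sub_circleMap_comm (s t θ : ℝ) :
    ‖circleMap 0 1 θ - circleMap 0 s t‖ ^ 2 = ‖circleMap 0 1 t - circleMap 0 s θ‖ ^ 2 := by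
  simp only [← Complex.normSq_eq_norm_sq, Complex.normSq_apply, circleMap, zero_add]
  simp [Complex.exp_re, Complex.exp_im]
  linear_combination (1 - s ^ 2) * Real.sin_sq_add_cos_sq θ -
    (1 - s ^ 2) * Real.sin_sq_add_cos_sq t

/-- This symmetry makes an average over poles on a circle an ordinary Poisson integral, so that the
mass and concentration of the kernel apply to `poissonMean`. -/
theorem poissonAngle_circleMap_comm (s t θ : ℝ) :
    poissonAngle (circleMap 0 s t) θ = poissonAngle (circleMap 0 s θ) t := by
  rw [poissonAngle_circleMap, poissonAngle_circleMap, norm_circleMap_sub_circleMap_comm]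

theorem continuous_poissonAngle_circleMap {s : ℝ} (hs : s ∈ Ioo (0 : ℝ) 1) :
    Continuous fun x : ℝ × ℝ => poissonAngle (circleMap 0 s x.1) x.2 := by
  simp only [poissonAngle_circleMap]
  refine Continuous.div (by fun_prop) ?_ fun x => ?_
  · exact (((continuous_circleMap 0 1).comp continuous_snd).sub
      ((continuous_circleMap 0 s).comp continuous_fst)).norm.pow 2
  · exact pow_ne_zero 2 (norm_ne_zero_iff.2 (sub_ne_zero_of_mem_sphere_of_mem_ball
      (circleMap_mem_ball hs _) (circleMap_one_mem_sphere _)))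

theorem poissonAngle_circleMap_le {s : ℝ} (hs : s ∈ Ioo (0 : ℝ) 1) (t θ : ℝ) :
    poissonAngle (circleMap 0 s t) θ ≤ (1 - s ^ 2) / (1 - s) ^ 2 := by
  rw [poissonAngle_circleMap]
  have h := norm_sub_norm_le (circleMap 0 1 θ) (circleMap 0 s t)
  rw [norm_circleMap_zero, norm_circleMap_zero, abs_one, abs_of_pos hs.1] at h
  have h1 : 0 < 1 - s := by linarith [hs.2]
  have h2 : 0 ≤ 1 - s ^ 2 := by nlinarith [hs.1]
  gcongr

/-- The mean of `v` on the circle of radius `s` against the Poisson kernel with pole at the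
boundary point of angle `θ`. -/
noncomputable def poissonMean (v : ℂ → ℝ) (s θ : ℝ) : ℝ :=
  (2 * Real.pi)⁻¹ *
    ∫ t, poissonAngle (circleMap 0 s t) θ * v (circleMap 0 s t) ∂angleMeasure

section poissonMean

variable {v : ℂ → ℝ}

theorem integrable_comp_circleMap (hv : ContinuousOn v (ball 0 1)) {s : ℝ}
    (hs : s ∈ Ioo (0 : ℝ) 1) : Integrable (fun t => v (circleMap 0 s t)) angleMeasure := by
  have hc := hv.comp_continuous (continuous_circleMap 0 s) (circleMap_mem_ball hs)
  exact (hc.integrableOn_Icc (a := 0) (b := 2 * Real.pi)).mono_set Ioc_subset_Icc_self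

theorem poissonMean_eq (s θ : ℝ) :
    poissonMean v s θ = (2 * Real.pi)⁻¹ *
      ∫ t, poissonAngle (circleMap 0 s θ) t * v (circleMap 0 s t) ∂angleMeasure := by
  simp only [poissonMean, poissonAngle_circleMap_comm s _ θ]

theorem abs_poissonMean_le_one (hv : ContinuousOn v (ball 0 1))
    (hv01 : ∀ z ∈ ball (0 : ℂ) 1, v z ∈ Icc (0 : ℝ) 1) {s : ℝ} (hs : s ∈ Ioo (0 : ℝ) 1) (θ : ℝ) :
    |poissonMean v s θ| ≤ 1 := by
  have hw := circleMap_mem_ball hs θ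
  rw [poissonMean_eq, abs_of_nonneg, ← integral_poissonAngle hw]
  · refine mul_le_mul_of_nonneg_left (integral_mono (integrable_poissonAngle_mul hw
      (integrable_comp_circleMap hv hs)) ((memLp_poissonAngle hw 1).integrable le_rfl)
      fun t => ?_) (by positivity)
    exact mul_le_of_le_one_right (poissonAngle_nonneg hw t) (hv01 _ (circleMap_mem_ball hs t)).2
  · exact mul_nonneg (by positivity) (integral_nonneg fun t =>
      mul_nonneg (poissonAngle_nonneg hw t) (hv01 _ (circleMap_mem_ball hs t)).1)

/-- Approximate identity: within δ of the boundary point continuity gives ε / 2, and farther away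
the kernel is at most (1 - s²) / δ². Continuity is that of v in the plane, since the integrand lives
on the circle of radius s. -/
theorem tendsto_poissonMean (hv : ContinuousOn v (ball 0 1))
    (hv01 : ∀ z ∈ ball (0 : ℂ) 1, v z ∈ Icc (0 : ℝ) 1) {θ : ℝ}
    (hθ : ContinuousAt v (circleMap 0 1 θ)) (hθ01 : v (circleMap 0 1 θ) ∈ Icc (0 : ℝ) 1) :
    Tendsto (fun s => poissonMean v s θ) (𝓝[<] 1) (𝓝 (v (circleMap 0 1 θ))) := by
  set v₀ := v (circleMap 0 1 θ) with hv₀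
  rw [Metric.tendsto_nhds]
  intro ε hε
  obtain ⟨δ, hδ, hδv⟩ := Metric.continuousAt_iff.1 hθ (ε / 2) (half_pos hε)
  have hlim : Tendsto (fun s : ℝ => (1 - s ^ 2) / δ ^ 2) (𝓝[<] 1) (𝓝 0) := by
    have : ContinuousAt (fun s : ℝ => (1 - s ^ 2) / δ ^ 2) 1 := by fun_prop
    have h := this.tendsto.mono_left (nhdsWithin_le_nhds (s := Iio 1))
    simpa using h
  filter_upwards [Ioo_mem_nhdsLT (zero_lt_one' ℝ), hlim.eventually (gt_mem_nhds (half_pos hε))]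
    with s hs hsδ
  have hw := circleMap_mem_ball hs θ
  have i0 : Integrable (poissonAngle (circleMap 0 s θ)) angleMeasure :=
    (memLp_poissonAngle hw 1).integrable le_rfl
  have iv := integrable_poissonAngle_mul hw (integrable_comp_circleMap hv hs)
  have e : poissonMean v s θ - v₀ = (2 * Real.pi)⁻¹ * ∫ t, poissonAngle (circleMap 0 s θ) t *
      (v (circleMap 0 s t) - v₀) ∂angleMeasure := by
    have h1 := integral_poissonAngle hw
    simp only [mul_sub]
    rw [integral_sub iv (i0.mul_const _), integral_mul_const, mul_sub, ← mul_assoc, h1, one_mul,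
      poissonMean_eq]
  have hbd : ∀ t, |poissonAngle (circleMap 0 s θ) t * (v (circleMap 0 s t) - v₀)| ≤
      ε / 2 * poissonAngle (circleMap 0 s θ) t + (1 - s ^ 2) / δ ^ 2 := by
    intro t
    have hP := poissonAngle_nonneg hw t
    have hs2 : 0 ≤ 1 - s ^ 2 := by nlinarith [hs.1, hs.2]
    rw [abs_mul, abs_of_nonneg hP]
    by_cases h : dist (circleMap 0 s t) (circleMap 0 1 θ) < δ
    · have h1 := hδv h
      rw [Real.dist_eq] at h1
      have h2 : 0 ≤ (1 - s ^ 2) / δ ^ 2 := by positivity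
      nlinarith
    · have h1 : |v (circleMap 0 s t) - v₀| ≤ 1 := by
        have h2 := hv01 _ (circleMap_mem_ball hs t)
        rw [abs_le]; constructor <;> linarith [h2.1, h2.2, hθ01.1, hθ01.2]
      have h2 : poissonAngle (circleMap 0 s θ) t ≤ (1 - s ^ 2) / δ ^ 2 := by
        rw [← poissonAngle_circleMap_comm, poissonAngle_circleMap]
        rw [not_lt, dist_comm, dist_eq_norm] at h
        gcongr
      nlinarith
  rw [Real.dist_eq, e, abs_mul, abs_of_nonneg (by positivity : 0 ≤ (2 * Real.pi)⁻¹)]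
  have h1 : |∫ t, poissonAngle (circleMap 0 s θ) t * (v (circleMap 0 s t) - v₀) ∂angleMeasure| ≤
      ∫ t, (ε / 2 * poissonAngle (circleMap 0 s θ) t + (1 - s ^ 2) / δ ^ 2) ∂angleMeasure :=
    norm_integral_le_of_norm_le (f := fun t => poissonAngle (circleMap 0 s θ) t *
      (v (circleMap 0 s t) - v₀)) (g := fun t => ε / 2 * poissonAngle (circleMap 0 s θ) t +
      (1 - s ^ 2) / δ ^ 2) ((i0.const_mul _).add (integrable_const _)) (Eventually.of_forall hbd)
  rw [integral_add (i0.const_mul _) (integrable_const _), integral_const_mul] at h1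
  have h2 : ∫ _ : ℝ, (1 - s ^ 2) / δ ^ 2 ∂angleMeasure =
      2 * Real.pi * ((1 - s ^ 2) / δ ^ 2) := by
    simp [measureReal_def, Real.pi_pos.le]
  have h3 := mul_le_mul_of_nonneg_left h1 (by positivity : 0 ≤ (2 * Real.pi)⁻¹)
  refine h3.trans_lt ?_
  rw [h2, mul_add, mul_left_comm, integral_poissonAngle hw,
    inv_mul_cancel_left₀ Real.two_pi_pos.ne']
  linarith

theorem integrable_prod_poissonAngle (hv : ContinuousOn v (ball 0 1)) {s : ℝ}
    (hs : s ∈ Ioo (0 : ℝ) 1) {G : ℝ → ℝ} (hG : Integrable G angleMeasure) :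
    Integrable (fun x : ℝ × ℝ => v (circleMap 0 s x.1) *
      (poissonAngle (circleMap 0 s x.1) x.2 * G x.2)) (angleMeasure.prod angleMeasure) := by
  have h1 : Integrable (fun x : ℝ × ℝ => v (circleMap 0 s x.1) * G x.2)
      (angleMeasure.prod angleMeasure) := (integrable_comp_circleMap hv hs).mul_prod hG
  have h2 := h1.bdd_mul (c := (1 - s ^ 2) / (1 - s) ^ 2)
    (continuous_poissonAngle_circleMap hs).aestronglyMeasurable
    (Eventually.of_forall fun x => by
      rw [Real.norm_of_nonneg (poissonAngle_nonneg (circleMap_mem_ball hs _) _)]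
      exact poissonAngle_circleMap_le hs _ _)
  refine h2.congr (Eventually.of_forall fun x => ?_)
  simp only
  ring

theorem aestronglyMeasurable_poissonMean (hv : ContinuousOn v (ball 0 1)) {s : ℝ}
    (hs : s ∈ Ioo (0 : ℝ) 1) : AEStronglyMeasurable (poissonMean v s) angleMeasure := by
  have h := (integrable_prod_poissonAngle hv hs (integrable_const (1 : ℝ))).swap.integral_prod_left
  refine (h.aestronglyMeasurable.const_mul (2 * Real.pi)⁻¹).congr
    (Eventually.of_forall fun θ => ?_)
  simp only [poissonMean, Prod.swap_prod_mk, mul_one, Function.comp_apply, mul_comm (v _)]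

/-- Insert the majorant of u, using v ≥ 0, and exchange the integrals: the kernel then acts on v,
whose boundary behaviour is known. -/
theorem integral_mul_le_integral_mul_poissonMean (hv : ContinuousOn v (ball 0 1))
    (hv01 : ∀ z ∈ ball (0 : ℂ) 1, v z ∈ Icc (0 : ℝ) 1) {s : ℝ} (hs : s ∈ Ioo (0 : ℝ) 1)
    {u : ℂ → ℝ} (hu : ContinuousOn u (ball 0 1)) {G : ℝ → ℝ} (hG : Integrable G angleMeasure)
    (huG : ∀ w ∈ ball (0 : ℂ) 1,
      u w ≤ (2 * Real.pi)⁻¹ * ∫ θ, poissonAngle w θ * G θ ∂angleMeasure) :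
    ∫ t, v (circleMap 0 s t) * u (circleMap 0 s t) ∂angleMeasure ≤
      ∫ θ, G θ * poissonMean v s θ ∂angleMeasure := by
  have hint := integrable_prod_poissonAngle hv hs hG
  have e : ∫ θ, G θ * poissonMean v s θ ∂angleMeasure = ∫ t, (2 * Real.pi)⁻¹ *
      ∫ θ, v (circleMap 0 s t) * (poissonAngle (circleMap 0 s t) θ * G θ) ∂angleMeasure
        ∂angleMeasure := by
    rw [integral_const_mul, integral_integral_swap hint, ← integral_const_mul]
    refine integral_congr_ae (Eventually.of_forall fun θ => ?_)
    simp only [poissonMean]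
    rw [mul_left_comm, ← integral_const_mul]
    congr 1
    refine integral_congr_ae (Eventually.of_forall fun t => ?_)
    simp only
    ring
  rw [e]
  refine integral_mono (integrable_comp_circleMap (hv.mul hu) hs)
    (hint.integral_prod_left.const_mul _) fun t => ?_
  have hw := circleMap_mem_ball hs t
  simp only
  rw [integral_const_mul, mul_left_comm]
  exact mul_le_mul_of_nonneg_left (huG _ hw) (hv01 _ hw).1

theorem tendsto_integral_mul_poissonMean (hv : ContinuousOn v (ball 0 1))
    (hv01 : ∀ z ∈ ball (0 : ℂ) 1, v z ∈ Icc (0 : ℝ) 1)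
    (hθ : ∀ᵐ θ ∂angleMeasure, ContinuousAt v (circleMap 0 1 θ) ∧
      v (circleMap 0 1 θ) ∈ Icc (0 : ℝ) 1)
    {G : ℝ → ℝ} (hG : Integrable G angleMeasure) :
    Tendsto (fun s => ∫ θ, G θ * poissonMean v s θ ∂angleMeasure) (𝓝[<] 1)
      (𝓝 (∫ θ, G θ * v (circleMap 0 1 θ) ∂angleMeasure)) := by
  have hs1 : ∀ᶠ s in 𝓝[<] (1 : ℝ), s ∈ Ioo (0 : ℝ) 1 := Ioo_mem_nhdsLT zero_lt_one
  refine tendsto_integral_filter_of_dominated_convergence (fun θ => |G θ|) ?_ ?_ hG.abs ?_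
  · filter_upwards [hs1] with s hs
    exact hG.aestronglyMeasurable.mul (aestronglyMeasurable_poissonMean hv hs)
  · filter_upwards [hs1] with s hs
    refine Eventually.of_forall fun θ => ?_
    rw [norm_mul, Real.norm_eq_abs, Real.norm_eq_abs]
    exact mul_le_of_le_one_right (abs_nonneg _) (abs_poissonMean_le_one hv hv01 hs θ)
  · filter_upwards [hθ] with θ h
    exact (tendsto_poissonMean hv hv01 h.1 h.2).const_mul _

end poissonMean

/-! ### Uniform decay of the means of F φ ^ k -/

/-- If `φ` has boundary values of modulus less than one almost everywhere, then the `p`-means of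
`F φ ^ k` tend to zero uniformly in the radius as `k → ∞`. -/
theorem exists_forall_integral_pow_mul_le {F φ : ℂ → ℂ} (hF : DifferentiableOn ℂ F (ball 0 1))
    {p : ℝ} (hp : 0 < p) {C : ℝ}
    (hC : ∀ r ∈ Ioo (0 : ℝ) 1, ∫ θ, ‖F (circleMap 0 r θ)‖ ^ p ∂angleMeasure ≤ C)
    (hφ : ContinuousOn φ (ball 0 1)) (hmaps : MapsTo φ (ball 0 1) (ball 0 1))
    (hφm : AEStronglyMeasurable (fun θ => φ (circleMap 0 1 θ)) angleMeasure)
    (hφb : ∀ᵐ θ ∂angleMeasure, ContinuousAt φ (circleMap 0 1 θ) ∧ ‖φ (circleMap 0 1 θ)‖ < 1)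
    {ε : ℝ} (hε : 0 < ε) :
    ∃ k : ℕ, ∀ s ∈ Ioo (0 : ℝ) 1,
      ∫ t, (‖φ (circleMap 0 s t)‖ ^ p) ^ k * ‖F (circleMap 0 s t)‖ ^ p ∂angleMeasure ≤ ε := by
  obtain ⟨G, hG, hFG⟩ := exists_poisson_majorant hF hp hC
  have hcont : Continuous fun x : ℂ => ‖x‖ ^ p :=
    continuous_norm.rpow_const fun _ => Or.inr hp.le
  have hlt : ∀ x : ℂ, ‖x‖ < 1 → ‖x‖ ^ p < 1 := fun x hx =>
    Real.rpow_lt_one (norm_nonneg x) hx hp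
  have hFc : ContinuousOn (fun z => ‖F z‖ ^ p) (ball 0 1) :=
    hcont.comp_continuousOn hF.continuousOn
  have hv : ∀ k : ℕ, ContinuousOn (fun z => (‖φ z‖ ^ p) ^ k) (ball 0 1) := fun k =>
    (hcont.comp_continuousOn hφ).pow k
  have hv01 : ∀ k : ℕ, ∀ z ∈ ball (0 : ℂ) 1, (‖φ z‖ ^ p) ^ k ∈ Icc (0 : ℝ) 1 := fun k z hz =>
    ⟨by positivity, pow_le_one₀ (by positivity) (hlt _ (mem_ball_zero_iff.1 (hmaps hz))).le⟩
  have hbdry : Tendsto (fun k : ℕ => ∫ θ, G θ * (‖φ (circleMap 0 1 θ)‖ ^ p) ^ k ∂angleMeasure)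
      atTop (𝓝 0) := by
    have h0 : ∫ θ, G θ * 0 ∂angleMeasure = 0 := by simp
    rw [← h0]
    refine tendsto_integral_filter_of_dominated_convergence (fun θ => |G θ|) ?_ ?_ hG.abs ?_
    · exact Eventually.of_forall fun k => hG.aestronglyMeasurable.mul
        ((hcont.comp_aestronglyMeasurable hφm).pow k)
    · refine Eventually.of_forall fun k => ?_
      filter_upwards [hφb] with θ h
      rw [norm_mul, Real.norm_eq_abs, Real.norm_of_nonneg (by positivity)]
      exact mul_le_of_le_one_right (abs_nonneg _) (pow_le_one₀ (by positivity) (hlt _ h.2).le)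
    · filter_upwards [hφb] with θ h
      exact (tendsto_pow_atTop_nhds_zero_of_lt_one (by positivity) (hlt _ h.2)).const_mul _
  -- The exponent k₀ settles all radii above some s₀ < 1, and any k ≥ k₀ does too because ‖φ‖ < 1.
  -- The final k is then enlarged to handle the radii up to s₀.
  obtain ⟨k₀, hk₀⟩ := (hbdry.eventually (gt_mem_nhds hε)).exists
  have hs := tendsto_integral_mul_poissonMean (hv k₀) (hv01 k₀) (by
    filter_upwards [hφb] with θ h
    exact ⟨(hcont.continuousAt.comp h.1).pow k₀, by positivity,
      pow_le_one₀ (by positivity) (hlt _ h.2).le⟩) hG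
  have hs' := (hs.eventually (gt_mem_nhds hk₀)).and
    (Ioo_mem_nhdsLT (zero_lt_one' ℝ) : ∀ᶠ s in 𝓝[<] (1 : ℝ), s ∈ Ioo (0 : ℝ) 1)
  obtain ⟨s₀, hs₀, hs₀s⟩ := (mem_nhdsLT_iff_exists_Ioo_subset).1 hs'
  have hs₀1 : s₀ < 1 := hs₀
  -- inside a fixed disc the powers decay geometrically
  obtain ⟨ρ, hρ0, hρ1, hρ⟩ : ∃ ρ, 0 ≤ ρ ∧ ρ < 1 ∧ ∀ z ∈ closedBall (0 : ℂ) s₀, ‖φ z‖ ^ p ≤ ρ := by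
    have hsub : closedBall (0 : ℂ) s₀ ⊆ ball 0 1 := closedBall_subset_ball hs₀1
    rcases (closedBall (0 : ℂ) s₀).eq_empty_or_nonempty with h | h
    -- Nothing prevents s₀ from being negative, in which case the ball is empty.
    · exact ⟨0, le_rfl, one_pos, fun z hz => absurd hz (h ▸ notMem_empty z)⟩
    · obtain ⟨z₀, hz₀, hmax⟩ := (isCompact_closedBall (0 : ℂ) s₀).exists_isMaxOn h
        ((hcont.comp_continuousOn hφ).mono hsub)
      exact ⟨‖φ z₀‖ ^ p, by positivity, hlt _ (mem_ball_zero_iff.1 (hmaps (hsub hz₀))),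
        fun z hz => hmax hz⟩
  have ht : Tendsto (fun k : ℕ => ρ ^ k * C) atTop (𝓝 0) := by
    simpa using (tendsto_pow_atTop_nhds_zero_of_lt_one hρ0 hρ1).mul_const C
  obtain ⟨k, hkC, hk⟩ := ((ht.eventually (gt_mem_nhds hε)).and (eventually_ge_atTop k₀)).exists
  refine ⟨k, fun s hs => ?_⟩
  have hint := integrable_comp_circleMap ((hv k).mul hFc) hs
  rcases lt_or_ge s₀ s with h | h
  · have h1 := (hs₀s ⟨h, hs.2⟩).1
    refine le_trans ?_ ((integral_mul_le_integral_mul_poissonMean (hv k₀) (hv01 k₀) hs hFc hG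
      hFG).trans h1.le)
    refine integral_mono hint (integrable_comp_circleMap ((hv k₀).mul hFc) hs) fun t => ?_
    refine mul_le_mul_of_nonneg_right ?_ (by positivity)
    exact pow_le_pow_of_le_one (by positivity)
      (hlt _ (mem_ball_zero_iff.1 (hmaps (circleMap_mem_ball hs t)))).le hk
  · refine le_trans ?_ (((mul_le_mul_of_nonneg_left (hC s hs) (pow_nonneg hρ0 k))).trans hkC.le)
    rw [← integral_const_mul]
    refine integral_mono hint ((integrable_comp_circleMap hFc hs).const_mul _) fun t => ?_
    refine mul_le_mul_of_nonneg_right ?_ (by positivity)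
    refine pow_le_pow_left₀ (by positivity) (hρ _ ?_) k
    rw [mem_closedBall_zero_iff, norm_circleMap_zero, abs_of_pos hs.1]
    exact h

/-! ### The dichotomy for |φ| on the punctured circle -/

theorem ae_circleMap_notMem_of_countable {s : Set ℂ} (hs : s.Countable) :
    ∀ᵐ θ ∂angleMeasure, circleMap 0 1 θ ∉ s := by
  rw [ae_restrict_iff' measurableSet_Ioc]
  have hc : {θ ∈ Ioc (0 : ℝ) (2 * Real.pi) | circleMap 0 1 θ ∈ s}.Countable := by
    refine MapsTo.countable_of_injOn (f := circleMap 0 1) (t := s) (fun θ hθ => hθ.2) ?_ hs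
    refine (injOn_circleMap_of_abs_sub_le (a := 0) (b := 2 * Real.pi) one_ne_zero ?_).mono ?_
    · rw [zero_sub, abs_neg, abs_of_pos Real.two_pi_pos]
    · rw [uIoc_of_le Real.two_pi_pos.le]; exact sep_subset _ _
  have h0 : ∀ᵐ θ : ℝ, θ ∉ {θ ∈ Ioc (0 : ℝ) (2 * Real.pi) | circleMap 0 1 θ ∈ s} :=
    measure_eq_zero_iff_ae_notMem.1 (hc.measure_zero volume)
  filter_upwards [h0] with θ hθ hθ1 hθs
  exact hθ ⟨hθ1, hθs⟩

section boundary

variable {a : ℂ} {Ω : Set ℂ} {φ : ℂ → ℂ}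

theorem norm_le_one_of_mem_sphere (hsub : closedBall (0 : ℂ) 1 \ {a} ⊆ Ω)
    (hφ : AnalyticOnNhd ℂ φ Ω) (hmaps : MapsTo φ (ball 0 1) (ball 0 1)) {z : ℂ} (hz : ‖z‖ = 1)
    (hza : z ≠ a) : ‖φ z‖ ≤ 1 := by
  have hc : ContinuousAt φ z :=
    (hφ z (hsub ⟨by simp [hz], hza⟩)).continuousAt
  have hcl : z ∈ closure (ball (0 : ℂ) 1) := by
    rw [closure_ball _ one_ne_zero]; simp [hz]
  have := mem_closure_iff_nhdsWithin_neBot.1 hcl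
  refine le_of_tendsto (hc.norm.tendsto.mono_left (nhdsWithin_le_nhds (s := ball 0 1))) ?_
  filter_upwards [self_mem_nhdsWithin] with w hw
  exact (mem_ball_zero_iff.1 (hmaps hw)).le

/-- The Cayley transform onto the circle punctured at `a`. -/
noncomputable def cayley (a : ℂ) (x : ℝ) : ℂ := a * (((x : ℂ) - Complex.I) / (x + Complex.I))

theorem ofReal_add_I_ne_zero (x : ℝ) : (x : ℂ) + Complex.I ≠ 0 := fun h => by
  simpa using congrArg Complex.im h

theorem norm_cayley (ha : ‖a‖ = 1) (x : ℝ) : ‖cayley a x‖ = 1 := by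
  have h : ‖(x : ℂ) - Complex.I‖ = ‖(x : ℂ) + Complex.I‖ := by
    rw [← Complex.norm_conj]; simp [sub_eq_add_neg]
  rw [cayley, norm_mul, ha, one_mul, norm_div, h,
    div_self (norm_ne_zero_iff.2 (ofReal_add_I_ne_zero x))]

theorem cayley_ne (ha : ‖a‖ = 1) (x : ℝ) : cayley a x ≠ a := by
  intro h
  have ha0 : a ≠ 0 := norm_ne_zero_iff.1 (by rw [ha]; exact one_ne_zero)
  rw [cayley, mul_eq_left₀ ha0, div_eq_one_iff_eq (ofReal_add_I_ne_zero x)] at h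
  have := congrArg Complex.im h
  simp at this
  linarith

theorem exists_cayley_eq (ha : ‖a‖ = 1) {z : ℂ} (hz : ‖z‖ = 1) (hza : z ≠ a) :
    ∃ x : ℝ, cayley a x = z := by
  have ha0 : a ≠ 0 := norm_ne_zero_iff.1 (by rw [ha]; exact one_ne_zero)
  have hd : a - z ≠ 0 := sub_ne_zero.2 hza.symm
  -- The inverse Cayley transform; it is real because conjugation inverts a and z.
  obtain ⟨x, hx⟩ : ∃ x : ℝ, (x : ℂ) = Complex.I * (a + z) / (a - z) := by
    suffices h : (starRingEnd ℂ) (Complex.I * (a + z) / (a - z)) = Complex.I * (a + z) / (a - z) by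
      obtain ⟨x, hx⟩ := Complex.conj_eq_iff_real.1 h
      exact ⟨x, hx.symm⟩
    have h1 : (starRingEnd ℂ) a = a⁻¹ := (Complex.inv_eq_conj ha).symm
    have h2 : (starRingEnd ℂ) z = z⁻¹ := (Complex.inv_eq_conj hz).symm
    have hz0 : z ≠ 0 := norm_ne_zero_iff.1 (by rw [hz]; exact one_ne_zero)
    rw [map_div₀, map_mul, map_add, map_sub, h1, h2, Complex.conj_I]
    have h3 : a⁻¹ - z⁻¹ = -(a - z) / (a * z) := by field_simp; ring
    have h4 : a⁻¹ + z⁻¹ = (a + z) / (a * z) := by field_simp; ring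
    rw [h3, h4]
    field_simp
  refine ⟨x, ?_⟩
  rw [cayley, ← mul_div_assoc, div_eq_iff (ofReal_add_I_ne_zero x), hx]
  field_simp
  ring

/-- Either `φ` is unimodular on the punctured circle or it is so only on a null set. -/
theorem forall_norm_eq_one_or_ae_norm_lt_one (ha : ‖a‖ = 1)
    (hsub : closedBall (0 : ℂ) 1 \ {a} ⊆ Ω) (hφ : AnalyticOnNhd ℂ φ Ω)
    (hmaps : MapsTo φ (ball 0 1) (ball 0 1)) :
    (∀ z, ‖z‖ = 1 → z ≠ a → ‖φ z‖ = 1) ∨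
      ∀ᵐ θ ∂angleMeasure, circleMap 0 1 θ ≠ a ∧ ‖φ (circleMap 0 1 θ)‖ < 1 := by
  -- The squared modulus is real-analytic even at zeros of φ, unlike the modulus.
  set h : ℝ → ℝ := fun x => Complex.normSq (φ (cayley a x)) - 1 with hh
  have hA : AnalyticOnNhd ℝ h univ := by
    intro x _
    have h1 : AnalyticAt ℝ (cayley a) x := by
      have e : AnalyticAt ℝ (fun x : ℝ => (x : ℂ)) x := Complex.ofRealCLM.analyticAt x
      exact analyticAt_const.mul ((e.sub analyticAt_const).div (e.add analyticAt_const)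
        (ofReal_add_I_ne_zero x))
    have h2 : AnalyticAt ℂ φ (cayley a x) :=
      hφ _ (hsub ⟨by simp [norm_cayley ha], cayley_ne ha x⟩)
    have h3 : AnalyticAt ℝ (fun x => φ (cayley a x)) x :=
      (h2.restrictScalars (𝕜 := ℝ)).fun_comp h1
    have h4 : AnalyticAt ℝ (fun x => (φ (cayley a x)).re) x :=
      (Complex.reCLM.analyticAt _).fun_comp h3
    have h5 : AnalyticAt ℝ (fun x => (φ (cayley a x)).im) x :=
      (Complex.imCLM.analyticAt _).fun_comp h3
    simp only [hh, Complex.normSq_apply]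
    exact ((h4.mul h4).add (h5.mul h5)).sub analyticAt_const
  have hiff : ∀ x, h x = 0 ↔ ‖φ (cayley a x)‖ = 1 := fun x => by
    simp only [hh, sub_eq_zero, Complex.normSq_eq_norm_sq]
    exact pow_eq_one_iff_of_nonneg (norm_nonneg _) two_ne_zero
  by_cases hz : ∃ x, ∀ᶠ y in 𝓝 x, h y = 0
  · left
    obtain ⟨x, hx⟩ := hz
    intro z hz1 hza
    obtain ⟨y, rfl⟩ := exists_cayley_eq ha hz1 hza
    exact (hiff y).1 (hA.eqOn_zero_of_preconnected_of_eventuallyEq_zero isPreconnected_univ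
      (mem_univ x) hx (mem_univ y))
  · right
    have hc : {x ∈ univ | h x = 0}.Countable := countable_setOf_eq_zero fun x _ =>
      ((hA x (mem_univ x)).eventually_eq_zero_or_eventually_ne_zero).resolve_left
        fun h0 => hz ⟨x, h0⟩
    filter_upwards [ae_circleMap_notMem_of_countable ((hc.image (cayley a)).union
      (countable_singleton a))] with θ hθ
    have hza : circleMap 0 1 θ ≠ a := fun h => hθ (Or.inr h)
    have hz1 : ‖circleMap 0 1 θ‖ = 1 := by simp
    refine ⟨hza, lt_of_le_of_ne (norm_le_one_of_mem_sphere hsub hφ hmaps hz1 hza) fun h1 => ?_⟩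
    obtain ⟨x, hx⟩ := exists_cayley_eq ha hz1 hza
    exact hθ (Or.inl ⟨x, ⟨mem_univ x, (hiff x).2 (by rw [hx, h1])⟩, hx⟩)

end boundary

/-! ### Lower bounds: the operator and the monomials -/

/-- Only this consequence of similarity is used. The constant is the condition number ‖S⁻¹‖ ‖S‖. -/
theorem IsSimilarToIsometry.exists_norm_le {E : Type*} [NormedAddCommGroup E] [NormedSpace ℂ E]
    {T : E →L[ℂ] E} (hT : IsSimilarToIsometry T) : ∃ M : ℝ, 0 ≤ M ∧ ∀ x, ‖x‖ ≤ M * ‖T x‖ := by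
  obtain ⟨S, U, h⟩ := hT
  refine ⟨‖(S.symm : E →L[ℂ] E)‖ * ‖(S : E →L[ℂ] E)‖, by positivity, fun x => ?_⟩
  have h1 : ‖S x‖ = ‖S (T x)‖ := by rw [h, S.apply_symm_apply, U.norm_map]
  calc ‖x‖ = ‖(S.symm : E →L[ℂ] E) (S x)‖ := by simp
    _ ≤ ‖(S.symm : E →L[ℂ] E)‖ * ‖S x‖ := ContinuousLinearMap.le_opNorm _ _
    _ = ‖(S.symm : E →L[ℂ] E)‖ * ‖(S : E →L[ℂ] E) (T x)‖ := by rw [h1]; rfl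
    _ ≤ ‖(S.symm : E →L[ℂ] E)‖ * (‖(S : E →L[ℂ] E)‖ * ‖T x‖) := by
      gcongr; exact ContinuousLinearMap.le_opNorm _ _
    _ = _ := by ring

theorem hardyMean_pow (p : ℝ) (k : ℕ) {r : ℝ} (hr : r ∈ Ioo (0 : ℝ) 1) :
    hardyMean p (fun z : 𝔻 => (z : ℂ) ^ k) r = (r ^ k) ^ p := by
  have e : ∀ θ, ‖discExt (fun z : 𝔻 => (z : ℂ) ^ k) (circleMap 0 r θ)‖ = r ^ k := fun θ => by
    have h : ‖circleMap 0 r θ‖ < 1 := mem_ball_zero_iff.1 (circleMap_mem_ball hr θ)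
    rw [discExt, dif_pos h]
    simp [abs_of_pos hr.1]
  rw [hardyMean_eq]
  simp only [e]
  simp [measureReal_def, Real.pi_pos.le]
  field_simp

theorem memHardy_pow {p : ℝ} (hp : 1 ≤ p) (k : ℕ) : MemHardy p fun z : 𝔻 => (z : ℂ) ^ k := by
  refine ⟨?_, 1, ?_⟩
  · refine (differentiableOn_pow k).congr fun z hz => ?_
    rw [discExt, dif_pos (mem_ball_zero_iff.1 hz)]
    rfl
  · rintro _ ⟨r, hr, rfl⟩
    rw [hardyMean_pow p k hr]
    exact Real.rpow_le_one (pow_nonneg hr.1.le k) (pow_le_one₀ hr.1.le hr.2.le) (by linarith)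

/-- The monomials as elements of the Hardy space. -/
noncomputable def HardySpace.monomial (p : ℝ) [Fact (1 ≤ p)] (k : ℕ) : HardySpace p :=
  ⟨fun z => (z : ℂ) ^ k, memHardy_pow Fact.out k⟩

theorem HardySpace.one_le_norm_monomial (p : ℝ) [hp : Fact (1 ≤ p)] (k : ℕ) :
    1 ≤ ‖HardySpace.monomial p k‖ := by
  have hp0 : 0 < p := zero_lt_one.trans_le hp.out
  have ht : Tendsto (fun r : ℝ => r ^ k) (𝓝[<] 1) (𝓝 1) := by
    have h : ContinuousAt (fun r : ℝ => r ^ k) 1 := by fun_prop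
    simpa using h.tendsto.mono_left (nhdsWithin_le_nhds (s := Iio 1))
  refine le_of_tendsto ht ?_
  filter_upwards [Ioo_mem_nhdsLT (zero_lt_one' ℝ)] with r hr
  have h := hardyMean_rpow_le hp.out (memHardy_pow hp.out k) hr
  rwa [hardyMean_pow p k hr, ← Real.rpow_mul (pow_nonneg hr.1.le k), mul_one_div_cancel hp0.ne',
    Real.rpow_one] at h

end HardyDisc

/-! ### The proposition -/

theorem mainTheorem3 (a : ℂ) (ha : ‖a‖ = 1) (Ω : Set ℂ) (hΩ : IsOpen Ω)
    (hsub : closedBall (0 : ℂ) 1 \ {a} ⊆ Ω) (φ : ℂ → ℂ) (hφ : AnalyticOnNhd ℂ φ Ω)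
    (hmaps : MapsTo φ (ball 0 1) (ball 0 1)) (p : ℝ) [Fact (1 ≤ p)] (ψ : 𝔻 → ℂ)
    (W : HardyDisc.HardySpace p →L[ℂ] HardyDisc.HardySpace p)
    (hW : HardyDisc.IsWeightedComposition (HardyDisc.discMap φ hmaps) ψ W)
    (hsim : HardyDisc.IsSimilarToIsometry W) :
    HardyDisc.IsInner φ := by
  open HardyDisc in
  have hp : (1 : ℝ) ≤ p := Fact.out
  have hp0 : 0 < p := by linarith
  have hballΩ : ball (0 : ℂ) 1 ⊆ Ω := fun z hz => hsub ⟨ball_subset_closedBall hz, fun h => by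
    rw [mem_singleton_iff.1 h, mem_ball_zero_iff, ha] at hz
    exact lt_irrefl _ hz⟩
  have hφd : DifferentiableOn ℂ φ (ball 0 1) := (hφ.mono hballΩ).differentiableOn
  have hcont : ∀ θ, circleMap 0 1 θ ≠ a → ContinuousAt φ (circleMap 0 1 θ) := fun θ hθ =>
    (hφ _ (hsub ⟨by simp, hθ⟩)).continuousAt
  have hne : ∀ᵐ θ ∂angleMeasure, circleMap 0 1 θ ≠ a := by
    filter_upwards [ae_circleMap_notMem_of_countable (countable_singleton a)] with θ hθ using hθ
  rcases forall_norm_eq_one_or_ae_norm_lt_one ha hsub hφ hmaps with h1 | h1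
  · refine ⟨hφd, fun z hz => (mem_ball_zero_iff.1 (hmaps hz)).le, ?_⟩
    filter_upwards [hne] with θ hθ
    refine ⟨φ (circleMap 0 1 θ), h1 _ (by simp) hθ, (hcont θ hθ).tendsto.comp ?_⟩
    have h2 : Continuous fun r : ℝ => circleMap 0 r θ := by
      simp only [circleMap]; fun_prop
    exact (h2.tendsto 1).mono_left nhdsWithin_le_nhds
  · exfalso
    have hφb : ∀ᵐ θ ∂angleMeasure,
        ContinuousAt φ (circleMap 0 1 θ) ∧ ‖φ (circleMap 0 1 θ)‖ < 1 := by
      filter_upwards [h1] with θ hθ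
      exact ⟨hcont θ hθ.1, hθ.2⟩
    -- The value of φ at a is arbitrary, so measurability comes from continuity on the open conull
    -- set of angles that avoid a.
    have hφm : AEStronglyMeasurable (fun θ => φ (circleMap 0 1 θ)) angleMeasure := by
      have hS : IsOpen {θ : ℝ | circleMap 0 1 θ ≠ a} :=
        isOpen_ne_fun (continuous_circleMap 0 1) continuous_const
      have h2 : ContinuousOn (fun θ => φ (circleMap 0 1 θ)) {θ : ℝ | circleMap 0 1 θ ≠ a} :=
        fun θ hθ => ((hcont θ hθ).comp (continuous_circleMap 0 1).continuousAt).continuousWithinAt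
      have h3 := h2.aestronglyMeasurable hS.measurableSet (μ := angleMeasure)
      rwa [Measure.restrict_eq_self_of_ae_mem (s := {θ : ℝ | circleMap 0 1 θ ≠ a}) hne] at h3
    obtain ⟨M, hM0, hM⟩ := hsim.exists_norm_le
    have hF : MemHardy p (W (HardySpace.monomial p 0)).toFun := (W (HardySpace.monomial p 0)).2
    set F := discExt (W (HardySpace.monomial p 0)).toFun with hFdef
    -- The image of the constant 1 is ψ itself, so F plays the role of the weight and lies in H^p.
    have hWF : ∀ k : ℕ, ∀ z ∈ ball (0 : ℂ) 1,
        discExt (W (HardySpace.monomial p k)).toFun z = φ z ^ k * F z := by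
      intro k z hz
      rw [mem_ball_zero_iff] at hz
      have e : ∀ k : ℕ, (W (HardySpace.monomial p k)).toFun (Complex.UnitDisc.mk z hz) =
          ψ (Complex.UnitDisc.mk z hz) * φ z ^ k := fun k => hW _ _
      rw [hFdef, discExt, discExt, dif_pos hz, dif_pos hz, e, e]
      ring
    obtain ⟨C, hC⟩ := hF.2
    have hC' : ∀ r ∈ Ioo (0 : ℝ) 1,
        ∫ θ, ‖F (circleMap 0 r θ)‖ ^ p ∂angleMeasure ≤ 2 * Real.pi * C := fun r hr => by
      have h2 := hC (mem_image_of_mem _ hr)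
      rw [hardyMean_eq, inv_mul_le_iff₀ Real.two_pi_pos] at h2
      exact h2
    -- Chosen so that M * ε < 1, with M + 1 keeping the denominator positive when M = 0.
    set ε : ℝ := 1 / (2 * (M + 1)) with hε
    have hε0 : 0 < ε := by positivity
    obtain ⟨k, hk⟩ := exists_forall_integral_pow_mul_le hF.1 hp0 hC' hφd.continuousOn hmaps hφm hφb
      (ε := 2 * Real.pi * ε ^ p) (by positivity)
    have hnorm : ‖W (HardySpace.monomial p k)‖ ≤ ε := by
      refine hardyNorm_le hp hε0.le fun r hr => ?_
      have h2 : hardyMean p (W (HardySpace.monomial p k)).toFun r ≤ ε ^ p := by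
        rw [hardyMean_eq, inv_mul_le_iff₀ Real.two_pi_pos]
        refine le_trans (le_of_eq ?_) (hk r hr)
        refine integral_congr_ae (Eventually.of_forall fun t => ?_)
        simp only
        rw [hWF k _ (circleMap_mem_ball hr t), norm_mul, norm_pow,
          Real.mul_rpow (by positivity) (norm_nonneg _), ← Real.rpow_natCast, ← Real.rpow_natCast,
          ← Real.rpow_mul (norm_nonneg _), ← Real.rpow_mul (norm_nonneg _), mul_comm p]
      refine (Real.rpow_le_rpow (hardyMean_nonneg _ _ _) h2 (by positivity)).trans ?_
      rw [← Real.rpow_mul hε0.le, mul_one_div_cancel hp0.ne', Real.rpow_one]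
    have h3 := (HardySpace.one_le_norm_monomial p k).trans (hM _)
    have h4 : M * ‖W (HardySpace.monomial p k)‖ ≤ M * ε := by gcongr
    have h5 : M * ε < 1 := by
      rw [hε, mul_one_div, div_lt_one (by positivity)]
      linarith
    linarith
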